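/- Let $n\ge 2$ and $0<\epsilon<\frac1{n-1}$. There is a constant $C$, depending only on $n$ and $\epsilon$ (hence only on $n$ once $\epsilon=\epsilon(n)$ is fixed), such that the following holds. Let $\bar g$ and $g=\bar g+h$ be smooth Riemannian metrics on a smooth $n$-manifold $U$ with $|h|_{\bar g}<\epsilon$ on $U$, and let $\Sigma^{n-1}$ be a smooth (immersed) hypersurface in $U$, with induced metrics $\bar\gamma,\gamma$. Let $\bar\nu$ be a smooth unit normal field along $\Sigma$ with respect to $\bar g$, and let $\nu$ be the unit normal with respect to $g$ that points to the same side of $\Sigma$. Let $\bar D, D$ be the Levi-Civita connections of $\bar g, g$, let $\bar A_{\alpha\beta}=-\langle \bar D_{\partial_\alpha}\partial_\beta,\bar\nu\rangle_{\bar g}$ and $A_{\alpha\beta}=-\langle D_{\partial_\alpha}\partial_\beta,\nu\rangle_{g}$ be the second fundamental forms, and let $\bar H=\bar\gamma^{\alpha\beta}\bar A_{\alpha\beta}$ and $H=\gamma^{\alpha\beta}A_{\alpha\beta}$ be the mean curvatures of $\Sigma$. Let $X$ be the vector field on $\Sigma$ dual to the $1$-form $h(\bar\nu,\cdot)|_{T\Sigma}$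 with respect to $\bar\gamma$. Then there are functions $R_1,R_2$ on $\Sigma$ with $$|R_1|\le C\,|h|_{\bar g}^2,\qquad |R_2|\le C\,|\bar D h|_{\bar g}\,|h|_{\bar g}$$ such that, at every point of $\Sigma$, $$2(H-\bar H)=\big(d\,\mathrm{tr}_{\bar g}h-\mathrm{div}_{\bar g}h\big)(\bar\nu)-\mathrm{div}_{\bar\gamma}X-\langle h,\bar A\rangle_{\bar\gamma}+|\bar A|\,R_1+R_2 .$$ Here $\mathrm{div}_{\bar g}$, $\mathrm{tr}_{\bar g}$ are the divergence and trace on $(U,\bar g)$, $\mathrm{div}_{\bar\gamma}$ is the divergence on $(\Sigma,\bar\gamma)$, $\langle h,\bar A\rangle_{\bar\gamma}$ is the inner product of $\bar A$ with the restriction of $h$ to $T\Sigma$, and the norms of $h$, $\bar Dh$ and $\bar A$ are the tensor norms taken with respect to $\bar g$. -/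

import Mathlib

open Manifold Bundle
open scoped ContDiff Topology

noncomputable section

namespace HypersurfaceGeometry

/-! ### Orthonormal frames of a scalar product on a vector space -/

/-- `e` is an orthonormal family for the bilinear form `B`. -/
def IsOrthonormalFrame {V : Type*} {k : ℕ} (B : V → V → ℝ) (e : Fin k → V) : Prop :=
  ∀ i j, B (e i) (e j) = if i = j then 1 else 0

open Classical in
/-- A `B`-orthonormal family of `k` vectors (`0` if there is none). It is used only for scalar
products `B` on `k`-dimensional spaces, where it is an orthonormal basis, and only inside
contractions, which do not depend on the choice. -/
def orthonormalFrame {V : Type*} [Zero V] {k : ℕ} (B : V → V → ℝ) : Fin k → V :=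
  if h : ∃ e : Fin k → V, IsOrthonormalFrame B e then h.choose else 0

/-- On a `k`-dimensional space with a scalar product the frame is orthonormal. -/
theorem isOrthonormalFrame_orthonormalFrame {V : Type*} [AddCommGroup V] [Module ℝ V]
    [FiniteDimensional ℝ V] {k : ℕ} (hk : Module.finrank ℝ V = k) (B : V →ₗ[ℝ] V →ₗ[ℝ] ℝ)
    (hsymm : ∀ v w, B v w = B w v) (hpos : ∀ v, v ≠ 0 → 0 < B v v) :
    IsOrthonormalFrame (fun v w => B v w)
      (orthonormalFrame (fun v w => B v w) : Fin k → V) := by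
  have hex : ∃ e : Fin k → V, IsOrthonormalFrame (fun v w => B v w) e := by
    let core : InnerProductSpace.Core ℝ V :=
      { inner := fun v w => B v w
        conj_inner_symm := fun v w => by simpa using hsymm w v
        re_inner_nonneg := fun v => by
          by_cases hv : v = 0
          · simp [hv]
          · simpa using (hpos v hv).le
        add_left := fun u v w => by simp
        smul_left := fun v w r => by simp
        definite := fun v hv => by
          by_contra h
          exact (hpos v h).ne' hv }
    let _ : NormedAddCommGroup V := core.toNormedAddCommGroup
    let _ : InnerProductSpace ℝ V := InnerProductSpace.ofCore core.toCore
    let b := (stdOrthonormalBasis ℝ V).reindex (finCongr hk)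
    exact ⟨b, fun i j => (orthonormal_iff_ite.mp b.orthonormal) i j⟩
  rw [orthonormalFrame, dif_pos hex]
  exact hex.choose_spec

/-! ### Tensor calculus on an `n`-dimensional manifold

A tangent vector at `x` is identified by Mathlib with the vector of its coordinates in the
preferred chart at `x`; local expressions below are taken in that chart. -/

section Calculus

variable {n : ℕ} {M : Type*} [TopologicalSpace M] [ChartedSpace (EuclideanSpace ℝ (Fin n)) M]

/-- A smooth Riemannian metric on the `n`-dimensional manifold `M`. -/
abbrev Metric (n : ℕ) (M : Type*) [TopologicalSpace M]
    [ChartedSpace (EuclideanSpace ℝ (Fin n)) M] [IsManifold (𝓡 n) ∞ M] : Type _ :=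
  ContMDiffRiemannianMetric (𝓡 n) ∞ (EuclideanSpace ℝ (Fin n))
    (fun x : M => TangentSpace (𝓡 n) x)

/-- A field of bilinear forms (covariant `2`-tensor field) on `M`. -/
abbrev TwoTensor (n : ℕ) (M : Type*) [TopologicalSpace M]
    [ChartedSpace (EuclideanSpace ℝ (Fin n)) M] : Type _ :=
  (x : M) → TangentSpace (𝓡 n) x →L[ℝ] TangentSpace (𝓡 n) x →L[ℝ] ℝ

/-- The `g`-orthonormal frame of the tangent space at `x`. -/
def frame (g : TwoTensor n M) (x : M) : Fin n → TangentSpace (𝓡 n) x :=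
  orthonormalFrame (fun v w => g x v w)

/-- The component `u ↦ h_{ij}(u) aⁱ bʲ` of `h` in the preferred chart at `x`, as a function of the
coordinates. -/
def tensorInChart (h : TwoTensor n M) (x : M) (a b u : EuclideanSpace ℝ (Fin n)) : ℝ :=
  h ((extChartAt (𝓡 n) x).symm u)
    (mfderiv 𝓘(ℝ, EuclideanSpace ℝ (Fin n)) (𝓡 n) (extChartAt (𝓡 n) x).symm u a)
    (mfderiv 𝓘(ℝ, EuclideanSpace ℝ (Fin n)) (𝓡 n) (extChartAt (𝓡 n) x).symm u b)

/-- The components `u ↦ Xⁱ(u)` of the vector field `X` in the preferred chart at `x`. -/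
def fieldInChart (X : (x : M) → TangentSpace (𝓡 n) x) (x : M) (u : EuclideanSpace ℝ (Fin n)) :
    EuclideanSpace ℝ (Fin n) :=
  mfderiv (𝓡 n) 𝓘(ℝ, EuclideanSpace ℝ (Fin n)) (extChartAt (𝓡 n) x)
    ((extChartAt (𝓡 n) x).symm u) (X ((extChartAt (𝓡 n) x).symm u))

/-- `∂_v h_{ij} aⁱ bʲ` at `x`: the partial derivatives of the components of `h` in the preferred
chart at `x`. -/
def partialTensor (h : TwoTensor n M) (x : M) (v a b : TangentSpace (𝓡 n) x) : ℝ :=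
  fderiv ℝ (tensorInChart h x a b) (extChartAt (𝓡 n) x x) v

/-- The Christoffel symbols `Γᵏᵢⱼ vⁱ wʲ` of the Levi-Civita connection of `g` at `x` in the
preferred chart at `x`: the vector with
`g(Γ(v,w), z) = (∂_v g(w,z) + ∂_w g(v,z) - ∂_z g(v,w)) / 2` for all `z`. -/
def christoffel (g : TwoTensor n M) (x : M) (v w : TangentSpace (𝓡 n) x) : TangentSpace (𝓡 n) x :=
  ∑ k, ((1 / 2 : ℝ) * (partialTensor g x v w (frame g x k) + partialTensor g x w v (frame g x k)
    - partialTensor g x (frame g x k) v w)) • frame g x k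

/-- The covariant derivative `∇_v X` of a vector field for the Levi-Civita connection of `g`:
`vⁱ (∂ᵢ Xᵏ + Γᵏᵢⱼ Xʲ)`. -/
def covDerivField (g : TwoTensor n M) (X : (x : M) → TangentSpace (𝓡 n) x) (x : M)
    (v : TangentSpace (𝓡 n) x) : TangentSpace (𝓡 n) x :=
  let dX : TangentSpace (𝓡 n) x := fderiv ℝ (fieldInChart X x) (extChartAt (𝓡 n) x x) v
  dX + christoffel g x v (X x)

/-- The covariant derivative `(∇_v h)(a, b)` of a `2`-tensor for the Levi-Civita connection of
`g`. -/
def covDerivTensor (g h : TwoTensor n M) (x : M) (v a b : TangentSpace (𝓡 n) x) : ℝ :=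
  partialTensor h x v a b - h x (christoffel g x v a) b - h x a (christoffel g x v b)

/-- The trace `tr_g h`. -/
def trace (g h : TwoTensor n M) (x : M) : ℝ :=
  ∑ i, h x (frame g x i) (frame g x i)

/-- The norm `|h|_g` of a `2`-tensor. -/
def tensorNorm (g h : TwoTensor n M) (x : M) : ℝ :=
  √(∑ i, ∑ j, h x (frame g x i) (frame g x j) ^ 2)

/-- The norm `|∇h|_g` of the covariant derivative of a `2`-tensor. -/
def covDerivNorm (g h : TwoTensor n M) (x : M) : ℝ :=
  √(∑ i, ∑ j, ∑ k, covDerivTensor g h x (frame g x i) (frame g x j) (frame g x k) ^ 2)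

/-- The divergence `div_g h`, a `1`-form. -/
def divTensor (g h : TwoTensor n M) (x : M) (v : TangentSpace (𝓡 n) x) : ℝ :=
  ∑ i, covDerivTensor g h x (frame g x i) (frame g x i) v

/-- The divergence `div_g X` of a vector field. -/
def divField (g : TwoTensor n M) (X : (x : M) → TangentSpace (𝓡 n) x) (x : M) : ℝ :=
  ∑ i, g x (covDerivField g X x (frame g x i)) (frame g x i)

/-- The vector field dual to the `1`-form `α` with respect to `g`. -/
def dualField (g : TwoTensor n M) (α : (x : M) → TangentSpace (𝓡 n) x → ℝ) (x : M) :
    TangentSpace (𝓡 n) x :=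
  ∑ i, α x (frame g x i) • frame g x i

end Calculus

/-! ### Immersed hypersurfaces -/

section Hypersurface

variable {n : ℕ} {S U : Type*}
  [TopologicalSpace S] [ChartedSpace (EuclideanSpace ℝ (Fin (n - 1))) S]
  [TopologicalSpace U] [ChartedSpace (EuclideanSpace ℝ (Fin n)) U]

/-- The differential `dι_p v` of `ι : S → U`. -/
def push (n : ℕ) {S U : Type*}
    [TopologicalSpace S] [ChartedSpace (EuclideanSpace ℝ (Fin (n - 1))) S]
    [TopologicalSpace U] [ChartedSpace (EuclideanSpace ℝ (Fin n)) U]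
    (ι : S → U) (p : S) (v : TangentSpace (𝓡 (n - 1)) p) : TangentSpace (𝓡 n) (ι p) :=
  mfderiv (𝓡 (n - 1)) (𝓡 n) ι p v

/-- `ι : S → U` is a smooth immersion. -/
def IsSmoothImmersion (n : ℕ) {S U : Type*}
    [TopologicalSpace S] [ChartedSpace (EuclideanSpace ℝ (Fin (n - 1))) S]
    [TopologicalSpace U] [ChartedSpace (EuclideanSpace ℝ (Fin n)) U] (ι : S → U) : Prop :=
  ContMDiff (𝓡 (n - 1)) (𝓡 n) ∞ ι ∧ ∀ p : S, Function.Injective (push n ι p)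

/-- The metric induced by `g` on `S`. -/
def inducedMetric (g : TwoTensor n U) (ι : S → U) : TwoTensor (n - 1) S := fun p =>
  let B : EuclideanSpace ℝ (Fin n) →L[ℝ] EuclideanSpace ℝ (Fin n) →L[ℝ] ℝ := g (ι p)
  let L : EuclideanSpace ℝ (Fin (n - 1)) →L[ℝ] EuclideanSpace ℝ (Fin n) :=
    mfderiv (𝓡 (n - 1)) (𝓡 n) ι p
  B.bilinearComp L L

/-- `ν` consists of unit normal vectors with respect to `g`. -/
def IsUnitNormal (g : TwoTensor n U) (ι : S → U)
    (ν : (p : S) → TangentSpace (𝓡 n) (ι p)) : Prop :=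
  ∀ p, g (ι p) (ν p) (ν p) = 1 ∧
    ∀ v : TangentSpace (𝓡 (n - 1)) p, g (ι p) (ν p) (push n ι p v) = 0

/-- `ν` is smooth as a vector field along `ι`. -/
def IsSmoothAlong (ι : S → U) [IsManifold (𝓡 n) 1 U]
    (ν : (p : S) → TangentSpace (𝓡 n) (ι p)) : Prop :=
  ContMDiff (𝓡 (n - 1)) (𝓡 n).tangent ∞ (fun p => (⟨ι p, ν p⟩ : TangentBundle (𝓡 n) U))

/-- `ν` and `ν'` point to the same side of the hypersurface: modulo vectors tangent to it, `ν` is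
a positive multiple of `ν'`. -/
def PointToSameSide (ι : S → U) (ν ν' : (p : S) → TangentSpace (𝓡 n) (ι p)) : Prop :=
  ∀ p, ∃ c : ℝ, 0 < c ∧ ∃ v : TangentSpace (𝓡 (n - 1)) p, ν p = c • ν' p + push n ι p v

/-- The covariant derivative `D_{∂_α} ∂_β` along `ι`, contracted with `v^α w^β`, where `∂_α` are
the coordinate fields on `S` of the preferred chart at `p` and `D` is the Levi-Civita connection
of `g`: `v^α w^β (∂_α ∂_β ιᵏ + Γᵏᵢⱼ ∂_α ιⁱ ∂_β ιʲ)`. -/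
def covDerivCoordField (g : TwoTensor n U) (ι : S → U) (p : S) (v w : TangentSpace (𝓡 (n - 1)) p) :
    TangentSpace (𝓡 n) (ι p) :=
  let ddι : TangentSpace (𝓡 n) (ι p) :=
    fderiv ℝ (fderiv ℝ (writtenInExtChartAt (𝓡 (n - 1)) (𝓡 n) p ι)) (extChartAt (𝓡 (n - 1)) p p) v w
  ddι + christoffel g (ι p) (push n ι p v) (push n ι p w)

/-- The second fundamental form `A_{αβ} = - g(D_{∂_α} ∂_β, ν)` with respect to `ν`. -/
def secondFundamentalForm (g : TwoTensor n U) (ι : S → U)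
    (ν : (p : S) → TangentSpace (𝓡 n) (ι p)) (p : S) (v w : TangentSpace (𝓡 (n - 1)) p) : ℝ :=
  - g (ι p) (covDerivCoordField g ι p v w) (ν p)

/-- The mean curvature `H = γ^{αβ} A_{αβ}` with respect to `ν`, where `γ` is the induced metric. -/
def meanCurvature (g : TwoTensor n U) (ι : S → U)
    (ν : (p : S) → TangentSpace (𝓡 n) (ι p)) (p : S) : ℝ :=
  ∑ a, secondFundamentalForm g ι ν p (frame (inducedMetric g ι) p a)
    (frame (inducedMetric g ι) p a)

/-- The norm `|A|` of the second fundamental form. -/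
def secondFundamentalFormNorm (g : TwoTensor n U) (ι : S → U)
    (ν : (p : S) → TangentSpace (𝓡 n) (ι p)) (p : S) : ℝ :=
  √(∑ a, ∑ b, secondFundamentalForm g ι ν p (frame (inducedMetric g ι) p a)
    (frame (inducedMetric g ι) p b) ^ 2)

/-- The inner product `⟨h, A⟩_γ` of the tangential restriction of `h` with the second fundamental
form, where `γ` is the metric induced by `g`. -/
def innerSecondFundamentalForm (g h : TwoTensor n U) (ι : S → U)
    (ν : (p : S) → TangentSpace (𝓡 n) (ι p)) (p : S) : ℝ :=
  ∑ a, ∑ b, h (ι p) (push n ι p (frame (inducedMetric g ι) p a))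
      (push n ι p (frame (inducedMetric g ι) p b))
    * secondFundamentalForm g ι ν p (frame (inducedMetric g ι) p a)
      (frame (inducedMetric g ι) p b)

/-- The vector field on `S` dual, with respect to the metric induced by `g`, to the `1`-form
`h(ν, ·)`. -/
def tangentialDual (g h : TwoTensor n U) (ι : S → U)
    (ν : (p : S) → TangentSpace (𝓡 n) (ι p)) : (p : S) → TangentSpace (𝓡 (n - 1)) p :=
  dualField (inducedMetric g ι) (fun p v => h (ι p) (ν p) (push n ι p v))

end Hypersurface

end HypersurfaceGeometry

end

/-! The statement is pointwise, and in coordinates at a point it is an identity between the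
`1`-jets of `ḡ` and `h` and the `2`-jet of the immersion `ι`, followed by an estimate.

Let `N` be the `ḡ`-normal and `ν` the `g`-normal, and let `∇h` be taken for `ḡ`. By the Koszul
formula the difference `T` of the two Levi-Civita connections satisfies
`2 g(T(u, v), w) = (∇_u h)(v, w) + (∇_v h)(u, w) - (∇_w h)(u, v)`. Since `ν` is `g`-orthogonal to
the hypersurface, only the normal component of `D̄_v w` contributes to `g(D̄_v w, ν)`, so
`2 A(v, w) = 2 g(N, ν) Ā(v, w) - ((∇_v h)(w, ν) + (∇_w h)(v, ν) - (∇_ν h)(v, w))` exactly. Taking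
the trace over a frame orthonormal for the metric induced by `g` gives `2 H`. Replacing that frame
by one orthonormal for `ḡ` and `ν` by `N` leaves the first-order part
`(2 + h(N, N)) H̄ - 2 ⟨h, Ā⟩ - ∑ (2 (∇_a h)(e_a, N) - (∇_N h)(e_a, e_a))`; everything else is
collected in the two remainders `HypersurfaceJet.curvatureRemainder` and
`HypersurfaceJet.derivativeRemainder`. The dual `X` of `h(N, ·)` has divergence
`∑ (∇_a h)(N, e_a) + ⟨h, Ā⟩ - h(N, N) H̄`, by differentiating `⟨X, e_b⟩ = h(N, e_b)` and using the
equations of Gauss and Weingarten. Adding the normal terms of `d tr h` and `div h`, which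
cancel, turns the first-order part into the one asserted: this is
`HypersurfaceJet.meanCurvature_sub`.

For the estimates put `η = |h| < ε < 1` and `K = 1 / (1 - ε)`. The metric induced by `g` has, in a
frame orthonormal for `ḡ`, the matrix `1 + h` with `g ≥ (1 - η) ḡ`, so its inverse is bounded by a
multiple of `K` and equals `1 - h` up to `O(η²)`; and `ν = c N + t` with `|t| = O(η)`,
`|c - 1| = O(η)`, while `κ = g(N, ν)` satisfies `κ² = 1 + h(N, N) + O(η²)`
(`abs_two_mul_sub_le`). Hence the two remainders are `O(|Ā| η²)` and `O(|∇h| η)`.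

The rest relates the jets to the geometric objects: the coordinate expressions of the tensor
fields are differentiable, `christoffel` is the vector determined by the Koszul formula, `∇` is
metric, so that the differential of `tr h` is the trace of `∇h` (`mvfderiv_trace`), and the
relations for the jet of a hypersurface (`hypersurfaceJet`) follow by differentiating
`γ̄ = ι^* ḡ`, `ḡ(N, N) = 1`, `ḡ(N, ∂_a) = 0` and `γ̄(X, ∂_b) = h(N, ∂_b)`.
-/

open Manifold Bundle
open scoped ContDiff Topology

noncomputable section

namespace HypersurfaceGeometry

/-! ### Orthonormal frames -/

section Frames

variable {V : Type*} [AddCommGroup V] [Module ℝ V] {k l : ℕ} {B : V →ₗ[ℝ] V →ₗ[ℝ] ℝ}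
  {e : Fin k → V} {e' : Fin l → V}

theorem IsOrthonormalFrame.apply_sum (he : IsOrthonormalFrame (fun v w => B v w) e)
    (c : Fin k → ℝ) (j : Fin k) : B (∑ i, c i • e i) (e j) = c j := by
  have he' : ∀ i j, B (e i) (e j) = if i = j then 1 else 0 := he
  simp [he']

theorem IsOrthonormalFrame.linearIndependent (he : IsOrthonormalFrame (fun v w => B v w) e) :
    LinearIndependent ℝ e := by
  rw [Fintype.linearIndependent_iff]
  intro c hc j
  rw [← he.apply_sum c j, hc]
  simp

variable [FiniteDimensional ℝ V]

theorem IsOrthonormalFrame.expand (he : IsOrthonormalFrame (fun v w => B v w) e)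
    (hk : Module.finrank ℝ V = k) (v : V) : v = ∑ i, B v (e i) • e i := by
  have hspan : v ∈ Submodule.span ℝ (Set.range e) := by
    rw [he.linearIndependent.span_eq_top_of_card_eq_finrank' (by simp [hk])]
    trivial
  obtain ⟨c, rfl⟩ := (Submodule.mem_span_range_iff_exists_fun ℝ).1 hspan
  exact Finset.sum_congr rfl fun i _ => by rw [he.apply_sum]

theorem IsOrthonormalFrame.ext (he : IsOrthonormalFrame (fun v w => B v w) e)
    (hk : Module.finrank ℝ V = k) {v w : V} (h : ∀ i, B v (e i) = B w (e i)) : v = w := by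
  rw [he.expand hk v, he.expand hk w]
  simp [h]

theorem IsOrthonormalFrame.apply_eq_sum (he : IsOrthonormalFrame (fun v w => B v w) e)
    (hk : Module.finrank ℝ V = k) (T : V →ₗ[ℝ] V →ₗ[ℝ] ℝ) (v w : V) :
    T v w = ∑ i, ∑ j, T (e i) (e j) * (B v (e i) * B w (e j)) := by
  conv_lhs => rw [he.expand hk v, he.expand hk w]
  simp only [map_sum, map_smul, LinearMap.sum_apply, LinearMap.smul_apply, smul_eq_mul,
    Finset.mul_sum]
  rw [Finset.sum_comm]
  exact Finset.sum_congr rfl fun i _ => Finset.sum_congr rfl fun j _ => by ring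

theorem IsOrthonormalFrame.inner_eq_sum (he : IsOrthonormalFrame (fun v w => B v w) e)
    (hk : Module.finrank ℝ V = k) (v w : V) : B v w = ∑ i, B v (e i) * B w (e i) := by
  have he' : ∀ i j, B (e i) (e j) = if i = j then 1 else 0 := he
  rw [he.apply_eq_sum hk B v w]
  simp [he']

/-- A vector dual to the linear form `α`, expressed in an orthonormal frame. -/
theorem IsOrthonormalFrame.inner_dual (he : IsOrthonormalFrame (fun v w => B v w) e)
    (hk : Module.finrank ℝ V = k) (α : V →ₗ[ℝ] ℝ) (w : V) :
    B (∑ i, α (e i) • e i) w = α w := by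
  conv_rhs => rw [he.expand hk w]
  rw [he.inner_eq_sum hk]
  simp only [he.apply_sum fun i => α (e i)]
  simp only [map_sum, map_smul, smul_eq_mul]
  exact Finset.sum_congr rfl fun i _ => by ring

theorem IsOrthonormalFrame.trace_eq (he : IsOrthonormalFrame (fun v w => B v w) e)
    (hk : Module.finrank ℝ V = k) (K : V →ₗ[ℝ] V) :
    LinearMap.trace ℝ V K = ∑ i, B (K (e i)) (e i) := by
  let b : Module.Basis (Fin k) ℝ V :=
    basisOfLinearIndependentOfCardEqFinrank' e he.linearIndependent (by simp [hk])
  have hb : ∀ i, b i = e i := fun i => by simp [b]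
  rw [LinearMap.trace_eq_matrix_trace ℝ b, Matrix.trace]
  refine Finset.sum_congr rfl fun i _ => ?_
  rw [Matrix.diag_apply, LinearMap.toMatrix_apply, hb]
  have h1 := b.sum_repr (K (e i))
  simp only [hb] at h1
  conv_rhs => rw [← h1]
  rw [he.apply_sum]

/-- The contraction of a bilinear form does not depend on the orthonormal frame. -/
theorem IsOrthonormalFrame.sum_eq_sum (he : IsOrthonormalFrame (fun v w => B v w) e)
    (hk : Module.finrank ℝ V = k) (he' : IsOrthonormalFrame (fun v w => B v w) e')
    (hl : Module.finrank ℝ V = l) (T : V →ₗ[ℝ] V →ₗ[ℝ] ℝ) :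
    ∑ i, T (e i) (e i) = ∑ j, T (e' j) (e' j) := by
  let K : V →ₗ[ℝ] V := ∑ i, (T.flip (e i)).smulRight (e i)
  have hK : ∀ v w, B (K v) w = T v w := fun v w => by
    rw [← he.inner_dual hk (T v) w]
    simp [K]
  simp only [← hK]
  rw [← he.trace_eq hk, ← he'.trace_eq hl]

/-! ### Cauchy-Schwarz inequalities for tensors -/

theorem IsOrthonormalFrame.self_nonneg (he : IsOrthonormalFrame (fun v w => B v w) e)
    (hk : Module.finrank ℝ V = k) (v : V) : 0 ≤ B v v := by
  rw [he.inner_eq_sum hk]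
  exact Finset.sum_nonneg fun i _ => mul_self_nonneg _

theorem IsOrthonormalFrame.abs_inner_le (he : IsOrthonormalFrame (fun v w => B v w) e)
    (hk : Module.finrank ℝ V = k) (v : V) (i : Fin k) : |B v (e i)| ≤ √(B v v) := by
  refine Real.abs_le_sqrt ?_
  rw [he.inner_eq_sum hk v v, sq]
  exact Finset.single_le_sum (f := fun i => B v (e i) * B v (e i))
    (fun i _ => mul_self_nonneg _) (Finset.mem_univ i)

theorem IsOrthonormalFrame.apply_sq_le (he : IsOrthonormalFrame (fun v w => B v w) e)
    (hk : Module.finrank ℝ V = k) (T : V →ₗ[ℝ] ℝ) (v : V) :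
    T v ^ 2 ≤ (∑ i, T (e i) ^ 2) * B v v := by
  have h1 : T v = ∑ i, T (e i) * B v (e i) := by
    conv_lhs => rw [he.expand hk v]
    simp [mul_comm]
  rw [h1, he.inner_eq_sum hk v v]
  simp only [← sq]
  exact Finset.sum_mul_sq_le_sq_mul_sq _ _ _

theorem IsOrthonormalFrame.abs_apply_le (he : IsOrthonormalFrame (fun v w => B v w) e)
    (hk : Module.finrank ℝ V = k) (T : V →ₗ[ℝ] ℝ) (v : V) :
    |T v| ≤ √(∑ i, T (e i) ^ 2) * √(B v v) := by
  rw [← Real.sqrt_mul (Finset.sum_nonneg fun i _ => sq_nonneg _)]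
  exact Real.abs_le_sqrt (he.apply_sq_le hk T v)

theorem IsOrthonormalFrame.abs_apply₂_le (he : IsOrthonormalFrame (fun v w => B v w) e)
    (hk : Module.finrank ℝ V = k) (T : V →ₗ[ℝ] V →ₗ[ℝ] ℝ) (v w : V) :
    |T v w| ≤ √(∑ i, ∑ j, T (e i) (e j) ^ 2) * √(B v v) * √(B w w) := by
  refine (he.abs_apply_le hk (T v) w).trans ?_
  gcongr
  rw [← Real.sqrt_mul (by positivity)]
  refine Real.sqrt_le_sqrt ?_
  rw [Finset.sum_comm, Finset.sum_mul]
  exact Finset.sum_le_sum fun j _ => he.apply_sq_le hk (T.flip (e j)) v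

theorem IsOrthonormalFrame.abs_apply₃_le (he : IsOrthonormalFrame (fun v w => B v w) e)
    (hk : Module.finrank ℝ V = k) (T : V →ₗ[ℝ] V →ₗ[ℝ] V →ₗ[ℝ] ℝ) (u v w : V) :
    |T u v w| ≤
      √(∑ i, ∑ j, ∑ l, T (e i) (e j) (e l) ^ 2) * √(B u u) * √(B v v) * √(B w w) := by
  refine (he.abs_apply₂_le hk (T u) v w).trans ?_
  gcongr
  rw [← Real.sqrt_mul (by positivity)]
  refine Real.sqrt_le_sqrt ?_
  refine (Finset.sum_le_sum fun j _ => Finset.sum_le_sum fun l _ =>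
    he.apply_sq_le hk ((T.flip (e j)).flip (e l)) u).trans_eq ?_
  simp only [← Finset.sum_mul, LinearMap.flip_apply]
  congr 1
  exact (Finset.sum_congr rfl fun j _ => Finset.sum_comm).trans Finset.sum_comm

end Frames

/-! ### The first variation at a point -/

/-- The jets of a metric, of a symmetric perturbation and of an immersed hypersurface at one point,
in coordinates, together with the relations that their derivatives satisfy there.

`G` and `H` are the values of the metric `ḡ` and of `h`, and `DG`, `DH` their first derivatives,
`Γ` and `Γg` are the Christoffel symbols of `ḡ` and of `g = ḡ + h`; `L` and `B` are the first and
second derivatives of the immersion, `ΓS` the Christoffel symbols of the metric induced by `ḡ`; `N`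
is the `ḡ`-unit normal, with derivative `dN`, and `ν` the `g`-unit normal; `X` is the dual of
`h(N, ·)` and `dX` its derivative. The frames `e`, `f` and `fg` are orthonormal for `ḡ`, for the
metric induced by `ḡ` and for the metric induced by `g`. -/
structure HypersurfaceJet (V W : Type*) [AddCommGroup V] [Module ℝ V] [AddCommGroup W] [Module ℝ W]
    (n m : ℕ) where
  G : V →ₗ[ℝ] V →ₗ[ℝ] ℝ
  H : V →ₗ[ℝ] V →ₗ[ℝ] ℝ
  DG : V →ₗ[ℝ] V →ₗ[ℝ] V →ₗ[ℝ] ℝ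
  DH : V →ₗ[ℝ] V →ₗ[ℝ] V →ₗ[ℝ] ℝ
  Γ : V →ₗ[ℝ] V →ₗ[ℝ] V
  Γg : V → V → V
  L : W →ₗ[ℝ] V
  B : W →ₗ[ℝ] W →ₗ[ℝ] V
  ΓS : W → W → W
  N : V
  dN : W → V
  ν : V
  X : W
  dX : W → W
  e : Fin n → V
  f : Fin m → W
  fg : Fin m → W
  finrank_V : Module.finrank ℝ V = n
  finrank_W : Module.finrank ℝ W = m
  dim : n = m + 1
  G_symm : ∀ v w, G v w = G w v
  H_symm : ∀ v w, H v w = H w v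
  DG_symm : ∀ u v w, DG u v w = DG u w v
  DH_symm : ∀ u v w, DH u v w = DH u w v
  e_frame : IsOrthonormalFrame (fun v w => G v w) e
  f_frame : IsOrthonormalFrame (fun v w => G.compl₁₂ L L v w) f
  fg_frame : IsOrthonormalFrame (fun v w => (G + H).compl₁₂ L L v w) fg
  koszul : ∀ u v w, 2 * G (Γ u v) w = DG u v w + DG v u w - DG w u v
  koszul_g : ∀ u v w, 2 * (G + H) (Γg u v) w =
    (DG + DH) u v w + (DG + DH) v u w - (DG + DH) w u v
  B_symm : ∀ v w, B v w = B w v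
  koszul_S : ∀ u v w, 2 * G (L (ΓS u v)) (L w) =
    (DG (L u) (L v) (L w) + G (B u v) (L w) + G (L v) (B u w))
    + (DG (L v) (L u) (L w) + G (B v u) (L w) + G (L u) (B v w))
    - (DG (L w) (L u) (L v) + G (B w u) (L v) + G (L u) (B w v))
  N_unit : G N N = 1
  N_normal : ∀ w, G N (L w) = 0
  dN_unit : ∀ v, DG (L v) N N + 2 * G (dN v) N = 0
  dN_normal : ∀ v w, DG (L v) N (L w) + G (dN v) (L w) + G N (B v w) = 0
  ν_unit : (G + H) ν ν = 1
  ν_normal : ∀ w, (G + H) ν (L w) = 0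
  ν_side : ∃ c : ℝ, 0 < c ∧ ∃ t : W, ν = c • N + L t
  X_dual : ∀ w, G (L X) (L w) = H N (L w)
  dX_dual : ∀ v w, DG (L v) (L X) (L w) + G (B v X) (L w) + G (L X) (B v w) + G (L (dX v)) (L w) =
    DH (L v) N (L w) + H (dN v) (L w) + H N (B v w)

/-- The trilinear form `(u, v, w) ↦ T u w v`. -/
def flipLast {V : Type*} [AddCommGroup V] [Module ℝ V] (T : V →ₗ[ℝ] V →ₗ[ℝ] V →ₗ[ℝ] ℝ) :
    V →ₗ[ℝ] V →ₗ[ℝ] V →ₗ[ℝ] ℝ where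
  toFun u := (T u).flip
  map_add' u v := by ext; simp
  map_smul' c u := by ext; simp

theorem flipLast_apply {V : Type*} [AddCommGroup V] [Module ℝ V]
    (T : V →ₗ[ℝ] V →ₗ[ℝ] V →ₗ[ℝ] ℝ) (u v w : V) : flipLast T u v w = T u w v := rfl

namespace HypersurfaceJet

variable {V W : Type*} [AddCommGroup V] [Module ℝ V] [AddCommGroup W] [Module ℝ W] {n m : ℕ}
  (J : HypersurfaceJet V W n m)

set_option maxSynthPendingDepth 3 in
/-- The covariant derivative of `h` for the Levi-Civita connection of `ḡ`. -/
def nablaH : V →ₗ[ℝ] V →ₗ[ℝ] V →ₗ[ℝ] ℝ :=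
  J.DH - J.Γ.compr₂ J.H - flipLast (J.Γ.compr₂ J.H)

theorem nablaH_apply (u v w : V) :
    J.nablaH u v w = J.DH u v w - J.H (J.Γ u v) w - J.H v (J.Γ u w) := by
  rw [J.H_symm v]
  rfl

/-- The second fundamental form of the hypersurface with respect to `ḡ`. -/
def A : W →ₗ[ℝ] W →ₗ[ℝ] ℝ :=
  -(J.B + J.Γ.compl₁₂ J.L J.L).compr₂ (J.G.flip J.N)

/-- The second fundamental form of the hypersurface with respect to `g`. -/
def Ag (v w : W) : ℝ := -(J.G + J.H) (J.B v w + J.Γg (J.L v) (J.L w)) J.ν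

theorem A_apply (v w : W) : J.A v w = -J.G (J.B v w + J.Γ (J.L v) (J.L w)) J.N := rfl

/-- The orthonormal frame consisting of the normal and of the tangential frame. -/
def adaptedFrame : Fin (m + 1) → V := Fin.cons J.N (J.L ∘ J.f)

theorem adaptedFrame_orthonormal : IsOrthonormalFrame (fun v w => J.G v w) J.adaptedFrame := by
  intro i j
  have hf : ∀ i j, J.G (J.L (J.f i)) (J.L (J.f j)) = if i = j then 1 else 0 := J.f_frame
  refine Fin.cases ?_ (fun i => ?_) i <;> refine Fin.cases ?_ (fun j => ?_) j
  · simp [adaptedFrame, J.N_unit]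
  · simp [adaptedFrame, J.N_normal, (Fin.succ_ne_zero j).symm]
  · simp [adaptedFrame, J.N_normal, J.G_symm _ J.N]
  · simp [adaptedFrame, hf]

theorem finrank_V_eq (J : HypersurfaceJet V W n m) : Module.finrank ℝ V = m + 1 :=
  J.finrank_V.trans J.dim

theorem DG_eq (u v w : V) : J.DG u v w = J.G (J.Γ u v) w + J.G v (J.Γ u w) := by
  have h1 := J.koszul u v w
  have h2 := J.koszul u w v
  rw [J.G_symm (J.Γ u w)] at h2
  linarith [J.DG_symm u v w, J.DG_symm v u w, J.DG_symm w u v]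

variable [FiniteDimensional ℝ V]

theorem ext_G {v w : V} (h : ∀ z, J.G v z = J.G w z) : v = w :=
  J.e_frame.ext J.finrank_V fun _ => h _

theorem ext_normal_tangent {v w : V} (hN : J.G v J.N = J.G w J.N)
    (hT : ∀ z, J.G v (J.L z) = J.G w (J.L z)) : v = w :=
  J.adaptedFrame_orthonormal.ext J.finrank_V_eq fun i => by
    refine Fin.cases ?_ (fun i => ?_) i
    · simpa [adaptedFrame] using hN
    · simpa [adaptedFrame] using hT _

theorem sum_frame (T : V →ₗ[ℝ] V →ₗ[ℝ] ℝ) :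
    ∑ i, T (J.e i) (J.e i) = T J.N J.N + ∑ a, T (J.L (J.f a)) (J.L (J.f a)) := by
  rw [J.e_frame.sum_eq_sum J.finrank_V J.adaptedFrame_orthonormal J.finrank_V_eq,
    Fin.sum_univ_succ]
  simp [adaptedFrame]

theorem Γ_symm (u v : V) : J.Γ u v = J.Γ v u :=
  J.ext_G fun z => by
    have h1 := J.koszul u v z
    have h2 := J.koszul v u z
    have h3 := J.DG_symm z u v
    linarith

/-- The Gauss formula. -/
theorem gauss (v w : W) :
    J.B v w + J.Γ (J.L v) (J.L w) = J.L (J.ΓS v w) - J.A v w • J.N := by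
  refine J.ext_normal_tangent ?_ fun z => ?_
  · rw [J.A_apply]
    simp [J.N_unit, J.G_symm _ J.N, J.N_normal]
  · have h1 := J.koszul_S v w z
    have h2 := J.koszul (J.L v) (J.L w) (J.L z)
    simp only [map_add, map_sub, map_smul, LinearMap.add_apply, LinearMap.sub_apply,
      LinearMap.smul_apply, J.N_normal, smul_zero, sub_zero]
    rw [J.B_symm w v, J.B_symm z v, J.B_symm z w, J.G_symm (J.B v z), J.G_symm (J.L v) (J.B w z),
      J.G_symm (J.B w z)] at h1
    linarith

/-- The difference of the two Levi-Civita connections in terms of `∇h`. -/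
theorem christoffel_sub (u v w : V) :
    2 * (J.G + J.H) (J.Γg u v - J.Γ u v) w =
      J.nablaH u v w + J.nablaH v u w - J.nablaH w u v := by
  have h1 := J.koszul_g u v w
  have h2 := J.koszul u v w
  simp only [LinearMap.add_apply, map_sub, LinearMap.sub_apply, nablaH_apply] at h1 ⊢
  rw [J.Γ_symm v u, J.Γ_symm w u, J.Γ_symm w v, J.H_symm (J.Γ u w) v]
  linarith

/-- The second fundamental form of `g` in terms of that of `ḡ` and of `∇h`. -/
theorem Ag_eq (v w : W) :
    2 * J.Ag v w = 2 * (J.G + J.H) J.N J.ν * J.A v w -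
      (J.nablaH (J.L v) (J.L w) J.ν + J.nablaH (J.L w) (J.L v) J.ν
        - J.nablaH J.ν (J.L v) (J.L w)) := by
  have hs : ∀ w, (J.G + J.H) (J.L w) J.ν = 0 := fun w => by
    rw [← J.ν_normal w]
    simp [J.G_symm _ J.ν, J.H_symm _ J.ν]
  rw [← J.christoffel_sub]
  have h : J.B v w + J.Γg (J.L v) (J.L w) =
      (J.L (J.ΓS v w) - J.A v w • J.N) + (J.Γg (J.L v) (J.L w) - J.Γ (J.L v) (J.L w)) := by
    rw [← J.gauss]
    abel
  rw [Ag, h]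
  generalize J.Γg (J.L v) (J.L w) - J.Γ (J.L v) (J.L w) = d
  rw [map_add, map_sub, map_smul, LinearMap.add_apply, LinearMap.sub_apply, hs,
    LinearMap.smul_apply, smul_eq_mul]
  ring

variable [FiniteDimensional ℝ W]

/-- The Weingarten equation. -/
theorem weingarten (v : W) :
    J.dN v + J.Γ (J.L v) J.N = ∑ b, J.A v (J.f b) • J.L (J.f b) := by
  refine J.ext_normal_tangent ?_ fun z => ?_
  · have h1 := J.dN_unit v
    rw [J.DG_eq, J.G_symm J.N] at h1
    simp only [map_add, map_sum, map_smul, LinearMap.add_apply, LinearMap.sum_apply,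
      LinearMap.smul_apply, J.G_symm _ J.N, J.N_normal, smul_zero, Finset.sum_const_zero]
    rw [J.G_symm J.N, J.G_symm J.N]
    linarith
  · have h1 := J.dN_normal v z
    have h2 : J.G (J.L (∑ b, J.A v (J.f b) • J.f b)) (J.L z) = J.A v z :=
      J.f_frame.inner_dual J.finrank_W (J.A v) z
    have h3 := J.A_apply v z
    rw [map_sum] at h2
    simp only [map_smul] at h2
    rw [J.DG_eq] at h1
    rw [h2, h3]
    simp only [map_add, LinearMap.add_apply, J.G_symm _ J.N]
    linarith

/-- The divergence of `X`. -/
theorem div_X :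
    ∑ a, J.G (J.L (J.dX (J.f a) + J.ΓS (J.f a) J.X)) (J.L (J.f a)) =
      ∑ a, J.nablaH (J.L (J.f a)) (J.L (J.f a)) J.N
      + ∑ a, ∑ b, J.H (J.L (J.f a)) (J.L (J.f b)) * J.A (J.f a) (J.f b)
      - J.H J.N J.N * ∑ a, J.A (J.f a) (J.f a) := by
  rw [Finset.mul_sum, ← Finset.sum_add_distrib, ← Finset.sum_sub_distrib]
  refine Finset.sum_congr rfl fun a _ => ?_
  generalize hv : J.f a = v
  -- the tangential connection is metric
  have h1 : J.DG (J.L v) (J.L J.X) (J.L v) + J.G (J.B v J.X) (J.L v) + J.G (J.L J.X) (J.B v v) =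
      J.G (J.L (J.ΓS v J.X)) (J.L v) + J.G (J.L J.X) (J.L (J.ΓS v v)) := by
    have h1 := J.koszul_S v J.X v
    have h2 := J.koszul_S v v J.X
    rw [J.G_symm (J.L (J.ΓS v v))] at h2
    rw [J.B_symm J.X v, J.G_symm (J.L v) (J.B v J.X)] at h1 h2
    rw [J.G_symm (J.L J.X) (J.B v v)] at *
    have h3 := J.DG_symm (J.L v) (J.L v) (J.L J.X)
    linarith
  have h2 := J.dX_dual v v
  have h3 := J.X_dual (J.ΓS v v)
  have h4 : J.H (J.dN v) (J.L v) + J.H (J.Γ (J.L v) J.N) (J.L v) =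
      ∑ b, J.H (J.L v) (J.L (J.f b)) * J.A v (J.f b) := by
    have h := congrArg (fun z => J.H z (J.L v)) (J.weingarten v)
    simp only [map_add, map_sum, map_smul, LinearMap.add_apply, LinearMap.sum_apply,
      LinearMap.smul_apply, smul_eq_mul] at h
    rw [h]
    exact Finset.sum_congr rfl fun b _ => by rw [mul_comm, J.H_symm]
  have h5 : J.H J.N (J.B v v) + J.H J.N (J.Γ (J.L v) (J.L v)) =
      J.H J.N (J.L (J.ΓS v v)) - J.H J.N J.N * J.A v v := by
    have h := congrArg (J.H J.N) (J.gauss v v)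
    simp only [map_add, map_sub, map_smul, smul_eq_mul] at h
    linarith
  rw [← h4, J.nablaH_apply, J.DH_symm]
  simp only [map_add, LinearMap.add_apply]
  rw [J.H_symm (J.Γ (J.L v) (J.L v)), J.H_symm (J.L v)]
  linarith

/-- The part of `2 (H - H̄)` beyond first order that involves the second fundamental form. -/
def curvatureRemainder : ℝ :=
  2 * (J.G + J.H) J.N J.ν * ∑ c, J.A (J.fg c) (J.fg c)
    - (2 + J.H J.N J.N) * ∑ a, J.A (J.f a) (J.f a)
    + 2 * ∑ a, ∑ b, J.H (J.L (J.f a)) (J.L (J.f b)) * J.A (J.f a) (J.f b)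

/-- The part of `2 (H - H̄)` beyond first order that involves `∇h`. -/
def derivativeRemainder : ℝ :=
  ∑ a, (2 * J.nablaH (J.L (J.f a)) (J.L (J.f a)) J.N - J.nablaH J.N (J.L (J.f a)) (J.L (J.f a)))
    - ∑ c, (2 * J.nablaH (J.L (J.fg c)) (J.L (J.fg c)) J.ν
      - J.nablaH J.ν (J.L (J.fg c)) (J.L (J.fg c)))

/-- The first variation of the mean curvature, with exact remainders. -/
theorem meanCurvature_sub :
    2 * (∑ c, J.Ag (J.fg c) (J.fg c) - ∑ a, J.A (J.f a) (J.f a)) =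
      (∑ i, J.nablaH J.N (J.e i) (J.e i) - ∑ i, J.nablaH (J.e i) (J.e i) J.N)
      - ∑ a, J.G (J.L (J.dX (J.f a) + J.ΓS (J.f a) J.X)) (J.L (J.f a))
      - ∑ a, ∑ b, J.H (J.L (J.f a)) (J.L (J.f b)) * J.A (J.f a) (J.f b)
      + J.curvatureRemainder + J.derivativeRemainder := by
  have h1 : 2 * ∑ c, J.Ag (J.fg c) (J.fg c) =
      2 * (J.G + J.H) J.N J.ν * ∑ c, J.A (J.fg c) (J.fg c)
      - ∑ c, (2 * J.nablaH (J.L (J.fg c)) (J.L (J.fg c)) J.ν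
      - J.nablaH J.ν (J.L (J.fg c)) (J.L (J.fg c))) := by
    rw [Finset.mul_sum, Finset.mul_sum, ← Finset.sum_sub_distrib]
    refine Finset.sum_congr rfl fun c _ => ?_
    rw [J.Ag_eq]
    ring
  have h2 := J.sum_frame (J.nablaH J.N)
  have h3 := J.sum_frame ((flipLast J.nablaH).flip J.N)
  simp only [LinearMap.flip_apply, flipLast_apply] at h3
  rw [mul_sub, h1, h2, h3, J.div_X, curvatureRemainder, derivativeRemainder]
  simp only [Finset.sum_sub_distrib, ← Finset.mul_sum]
  ring

end HypersurfaceJet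

/-! ### Estimates of the remainders -/

theorem abs_le_sqrt_sum_sq {m : ℕ} (a : Fin m → Fin m → ℝ) (i j : Fin m) :
    |a i j| ≤ √(∑ i, ∑ j, a i j ^ 2) := by
  refine Real.abs_le_sqrt ?_
  exact (Finset.single_le_sum (f := fun j => a i j ^ 2) (fun _ _ => sq_nonneg _)
    (Finset.mem_univ j)).trans (Finset.single_le_sum (f := fun i => ∑ j, a i j ^ 2)
      (fun _ _ => Finset.sum_nonneg fun _ _ => sq_nonneg _) (Finset.mem_univ i))

/-- If `κ ² = 1 + τ + σ` with `τ` of first order and `σ` of second order in `η`, then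
`κ = 1 + τ / 2` up to second order. -/
theorem abs_two_mul_sub_le {κ τ σ K η : ℝ} (hκ : 0 < κ) (h : κ ^ 2 = 1 + τ + σ) (hK : 0 ≤ K)
    (hη : 0 ≤ η) (hη1 : η ≤ 1) (hτ : |τ| ≤ η) (hσ : |σ| ≤ K * η ^ 2) :
    |κ - 1| ≤ (1 + K) * η ∧ |2 * κ - 2 - τ| ≤ 2 * ((1 + 2 * K) * η ^ 2) := by
  have hη2 : K * η ^ 2 ≤ K * η := by
    gcongr
    nlinarith
  have hdiv : ∀ x y : ℝ, |x * (κ + 1)| ≤ y → |x| ≤ y := fun x y hxy => by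
    rw [abs_mul, abs_of_pos (by linarith : 0 < κ + 1)] at hxy
    have : |x| * 1 ≤ |x| * (κ + 1) := by
      gcongr
      linarith
    linarith
  have hκ1 : |κ - 1| ≤ (1 + K) * η := by
    refine hdiv _ _ ?_
    rw [show (κ - 1) * (κ + 1) = τ + σ by linear_combination h]
    refine (abs_add_le _ _).trans ?_
    linarith
  refine ⟨hκ1, hdiv _ _ ?_⟩
  rw [show (2 * κ - 2 - τ) * (κ + 1) = 2 * σ - τ * (κ - 1) by linear_combination 2 * h]
  refine (abs_sub _ _).trans ?_
  rw [abs_mul, abs_mul τ, abs_two]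
  have h1 : |τ| * |κ - 1| ≤ η * ((1 + K) * η) := by gcongr
  nlinarith [mul_nonneg hK (sq_nonneg η)]

theorem abs_sum_le_mul {m : ℕ} (a : Fin m → ℝ) {C : ℝ} (h : ∀ i, |a i| ≤ C) :
    |∑ i, a i| ≤ m * C := by
  refine (Finset.abs_sum_le_sum_abs _ _).trans ((Finset.sum_le_sum fun i _ => h i).trans ?_)
  simp

theorem abs_sum_mul_le {m : ℕ} (a b : Fin m → ℝ) {C D : ℝ} (ha : ∀ i, |a i| ≤ C)
    (hb : ∀ i, |b i| ≤ D) : |∑ i, a i * b i| ≤ m * (C * D) :=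
  abs_sum_le_mul _ fun i => by
    rw [abs_mul]
    exact mul_le_mul (ha i) (hb i) (abs_nonneg _) ((abs_nonneg _).trans (ha i))

theorem abs_sum_sum_mul_le {m : ℕ} (a b : Fin m → Fin m → ℝ) {C D : ℝ} (ha : ∀ i j, |a i j| ≤ C)
    (hb : ∀ i j, |b i j| ≤ D) : |∑ i, ∑ j, a i j * b i j| ≤ m * (m * (C * D)) :=
  abs_sum_le_mul _ fun i => abs_sum_mul_le _ _ (ha i) (hb i)

namespace HypersurfaceJet

variable {V W : Type*} [AddCommGroup V] [Module ℝ V] [AddCommGroup W] [Module ℝ W] {n m : ℕ}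
  (J : HypersurfaceJet V W n m)

/-- The norm of `h`. -/
def normH : ℝ := √(∑ i, ∑ j, J.H (J.e i) (J.e j) ^ 2)

/-- The norm of `∇h`. -/
def normNablaH : ℝ := √(∑ i, ∑ j, ∑ k, J.nablaH (J.e i) (J.e j) (J.e k) ^ 2)

/-- The norm of the second fundamental form. -/
def normA : ℝ := √(∑ a, ∑ b, J.A (J.f a) (J.f b) ^ 2)

/-- The inverse of the metric induced by `g`, as a matrix in the frame `f`. -/
def invMetric : Matrix (Fin m) (Fin m) ℝ :=
  fun a b => ∑ c, J.G (J.L (J.fg c)) (J.L (J.f a)) * J.G (J.L (J.fg c)) (J.L (J.f b))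

/-- The tangential part of `h`, as a matrix in the frame `f`. -/
def tangentialH : Matrix (Fin m) (Fin m) ℝ :=
  fun a b => J.H (J.L (J.f a)) (J.L (J.f b))

theorem normH_nonneg : 0 ≤ J.normH := Real.sqrt_nonneg _

theorem normNablaH_nonneg : 0 ≤ J.normNablaH := Real.sqrt_nonneg _

theorem normA_nonneg : 0 ≤ J.normA := Real.sqrt_nonneg _

theorem abs_A_le (a b : Fin m) : |J.A (J.f a) (J.f b)| ≤ J.normA :=
  abs_le_sqrt_sum_sq (fun a b => J.A (J.f a) (J.f b)) a b

theorem G_f_self (a : Fin m) : J.G (J.L (J.f a)) (J.L (J.f a)) = 1 := by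
  have h := J.f_frame a a
  simpa using h

section

variable [FiniteDimensional ℝ W]

theorem sum_fg (T : W →ₗ[ℝ] W →ₗ[ℝ] ℝ) :
    ∑ c, T (J.fg c) (J.fg c) = ∑ a, ∑ b, J.invMetric a b * T (J.f a) (J.f b) := by
  have h : ∀ c, T (J.fg c) (J.fg c) = ∑ a, ∑ b, T (J.f a) (J.f b) *
      (J.G (J.L (J.fg c)) (J.L (J.f a)) * J.G (J.L (J.fg c)) (J.L (J.f b))) := fun c =>
    J.f_frame.apply_eq_sum J.finrank_W T (J.fg c) (J.fg c)
  simp only [h, invMetric, Finset.sum_mul]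
  rw [Finset.sum_comm]
  refine Finset.sum_congr rfl fun a _ => ?_
  rw [Finset.sum_comm]
  exact Finset.sum_congr rfl fun b _ => Finset.sum_congr rfl fun c _ => mul_comm _ _

theorem metric_mul_invMetric : (1 + J.tangentialH) * J.invMetric = 1 := by
  let F : Matrix (Fin m) (Fin m) ℝ := fun c a => J.G (J.L (J.fg c)) (J.L (J.f a))
  have hM : J.invMetric = F.transpose * F := by
    ext a b
    rfl
  have h : F * ((1 + J.tangentialH) * F.transpose) = 1 := by
    ext c d
    have h1 : (J.G + J.H).compl₁₂ J.L J.L (J.fg c) (J.fg d) = (1 : Matrix _ _ ℝ) c d := by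
      rw [Matrix.one_apply]
      exact J.fg_frame c d
    have h2 := J.f_frame.apply_eq_sum J.finrank_W ((J.G + J.H).compl₁₂ J.L J.L) (J.fg c) (J.fg d)
    have hf : ∀ i j, J.G (J.L (J.f i)) (J.L (J.f j)) = if i = j then 1 else 0 := J.f_frame
    rw [← h1, h2]
    have hF : ∀ c a, F c a = J.G (J.L (J.fg c)) (J.L (J.f a)) := fun _ _ => rfl
    have hP : ∀ a b, J.tangentialH a b = J.H (J.L (J.f a)) (J.L (J.f b)) := fun _ _ => rfl
    simp only [Matrix.mul_apply, Finset.mul_sum, Matrix.transpose_apply, Matrix.add_apply,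
      Matrix.one_apply, hP, LinearMap.compl₁₂_apply, LinearMap.add_apply, hf, hF]
    exact Finset.sum_congr rfl fun a _ => Finset.sum_congr rfl fun b _ => by ring
  rw [hM, ← Matrix.mul_assoc]
  exact mul_eq_one_comm.1 h

end

variable [FiniteDimensional ℝ V]

theorem G_self_nonneg (v : V) : 0 ≤ J.G v v := J.e_frame.self_nonneg J.finrank_V v

theorem abs_H_le (v w : V) : |J.H v w| ≤ J.normH * √(J.G v v) * √(J.G w w) :=
  J.e_frame.abs_apply₂_le J.finrank_V J.H v w

theorem abs_nablaH_le (u v w : V) :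
    |J.nablaH u v w| ≤ J.normNablaH * √(J.G u u) * √(J.G v v) * √(J.G w w) :=
  J.e_frame.abs_apply₃_le J.finrank_V J.nablaH u v w

theorem abs_tangentialH_le (a b : Fin m) : |J.tangentialH a b| ≤ J.normH := by
  have h := J.abs_H_le (J.L (J.f a)) (J.L (J.f b))
  rw [J.G_f_self, J.G_f_self, Real.sqrt_one, mul_one, mul_one] at h
  exact h

theorem G_le (v : V) : (1 - J.normH) * J.G v v ≤ (J.G + J.H) v v := by
  have h1 := J.abs_H_le v v
  rw [mul_assoc, Real.mul_self_sqrt (J.G_self_nonneg v)] at h1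
  have h2 := neg_abs_le (J.H v v)
  rw [LinearMap.add_apply, LinearMap.add_apply]
  linarith

section

variable {K : ℝ} (hK : 1 ≤ K * (1 - J.normH)) (hη : J.normH ≤ 1)
include hK hη

omit [FiniteDimensional ℝ V] in
theorem one_le_K : 1 ≤ K := by
  have h := J.normH_nonneg
  by_contra! hK1
  have : K * (1 - J.normH) ≤ 1 * (1 - J.normH) := by gcongr
  nlinarith

theorem G_le_of_le (v : V) : J.G v v ≤ K * (J.G + J.H) v v := by
  have hK1 := J.one_le_K hK hη
  have h := mul_le_mul_of_nonneg_left (J.G_le v) (by linarith : 0 ≤ K)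
  have h2 := mul_le_mul_of_nonneg_right hK (J.G_self_nonneg v)
  linarith

variable [FiniteDimensional ℝ W]

theorem abs_invMetric_le (a b : Fin m) : |J.invMetric a b| ≤ m * K := by
  refine abs_sum_le_mul _ fun c => ?_
  have h1 : J.G (J.L (J.fg c)) (J.L (J.fg c)) ≤ K := by
    have h := J.G_le_of_le hK hη (J.L (J.fg c))
    have h2 : (J.G + J.H) (J.L (J.fg c)) (J.L (J.fg c)) = 1 := by
      simpa using J.fg_frame c c
    rwa [h2, mul_one] at h
  have h2 : ∀ a, |J.G (J.L (J.fg c)) (J.L (J.f a))| ≤ √K := fun a =>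
    (J.f_frame.abs_inner_le J.finrank_W (J.fg c) a).trans (Real.sqrt_le_sqrt h1)
  rw [abs_mul]
  calc _ ≤ √K * √K := mul_le_mul (h2 a) (h2 b) (abs_nonneg _) (Real.sqrt_nonneg _)
    _ = K := Real.mul_self_sqrt (by linarith [J.one_le_K hK hη])

theorem abs_invMetric_sub_one_le (a b : Fin m) :
    |(J.invMetric - 1) a b| ≤ m * (J.normH * (m * K)) := by
  have h : J.invMetric - 1 = -(J.tangentialH * J.invMetric) := by
    have h := J.metric_mul_invMetric
    rw [add_mul, one_mul] at h
    rw [← h]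
    abel
  rw [h, Matrix.neg_apply, abs_neg, Matrix.mul_apply]
  exact abs_sum_mul_le _ _ (fun c => J.abs_tangentialH_le a c)
    fun c => J.abs_invMetric_le hK hη c b

/-- The first-order expansion of the inverse metric. -/
theorem abs_invMetric_sub_one_add_le (a b : Fin m) :
    |(J.invMetric - 1 + J.tangentialH) a b| ≤ m * (J.normH * (m * (J.normH * (m * K)))) := by
  have h : J.invMetric - 1 + J.tangentialH = -(J.tangentialH * (J.invMetric - 1)) := by
    have h := J.metric_mul_invMetric
    rw [add_mul, one_mul] at h
    rw [mul_sub, mul_one, ← h]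
    abel
  rw [h, Matrix.neg_apply, abs_neg, Matrix.mul_apply]
  exact abs_sum_mul_le _ _ (fun c => J.abs_tangentialH_le a c)
    fun c => J.abs_invMetric_sub_one_le hK hη c b

omit [FiniteDimensional ℝ W] in
/-- The expansion of the unit normal: with `κ = g(N, ν)`, the normal is `ν = κ⁻¹ N + L t` where `t`
is of first order in `h`, and `κ = 1 + h(N, N) / 2` up to second order. -/
theorem normal_expansion : ∃ κ c : ℝ, ∃ t : W, κ = (J.G + J.H) J.N J.ν ∧ J.ν = c • J.N + J.L t ∧
    0 ≤ κ ∧ κ ≤ 2 + K ∧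
    |κ - 1| ≤ (1 + K) * J.normH ∧
    |2 * κ - 2 - J.H J.N J.N| ≤ 2 * ((1 + 2 * K) * J.normH ^ 2) ∧
    |c - 1| ≤ (1 + K) * K * J.normH ∧
    √(J.G (J.L t) (J.L t)) ≤ K ^ 2 * J.normH ∧
    √(J.G J.ν J.ν) ≤ K := by
  have hK1 := J.one_le_K hK hη
  have hη0 := J.normH_nonneg
  obtain ⟨c, hc, t, hν⟩ := J.ν_side
  set η := J.normH
  set T := √(J.G (J.L t) (J.L t)) with hT
  have hT0 : 0 ≤ T := Real.sqrt_nonneg _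
  have hT2 : T ^ 2 = J.G (J.L t) (J.L t) := Real.sq_sqrt (J.G_self_nonneg _)
  set κ := (J.G + J.H) J.N J.ν with hκ
  have hN := J.N_unit
  have hNt := J.N_normal t
  have hsymm : ∀ v w, (J.G + J.H) v w = (J.G + J.H) w v := fun v w => by
    simp [J.G_symm v w, J.H_symm v w]
  set τ := J.H J.N J.N with hτ
  set s := J.H J.N (J.L t) with hs
  have hτb : |τ| ≤ η := by simpa [hN] using J.abs_H_le J.N J.N
  have hsb : |s| ≤ η * T := by simpa [hN] using J.abs_H_le J.N (J.L t)
  -- `c κ = g(ν, ν) = 1`, because `ν` is orthogonal to `L t`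
  have hcκ : c * κ = 1 := by
    have h := J.ν_unit
    conv at h => lhs; rw [hsymm]
    have h2 := J.ν_normal t
    rw [hsymm] at h2
    nth_rw 1 [hν] at h
    rw [map_add, LinearMap.add_apply, h2, map_smul, LinearMap.smul_apply, smul_eq_mul] at h
    linarith
  have hκe : κ = c * (1 + τ) + s := by
    rw [hκ, hν]
    simp [hN, hNt, hτ, hs]
    ring
  have hκ0 : 0 < κ := by
    by_contra! h
    nlinarith
  -- the tangential part of the normal
  have htt : c * s + (J.G + J.H) (J.L t) (J.L t) = 0 := by
    have h := J.ν_normal t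
    rw [hν] at h
    simp only [map_add, map_smul, LinearMap.add_apply, LinearMap.smul_apply, smul_eq_mul, hNt] at h
    simp only [LinearMap.add_apply]
    linarith
  have hTb : T ≤ K * (c * η) := by
    have h1 := J.G_le_of_le hK hη (J.L t)
    rw [← hT2] at h1
    have h2 : (J.G + J.H) (J.L t) (J.L t) ≤ c * (η * T) := by
      have := mul_le_mul_of_nonneg_left (neg_le_of_abs_le hsb) hc.le
      linarith
    have h3 : T * T ≤ (K * (c * η)) * T := by nlinarith
    by_contra! h4
    have h5 : 0 < T := lt_of_le_of_lt (by positivity) h4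
    nlinarith
  have hc2 : c ^ 2 ≤ J.G J.ν J.ν := by
    rw [hν]
    simp only [map_add, map_smul, LinearMap.add_apply, LinearMap.smul_apply, smul_eq_mul, hN, hNt,
      J.G_symm (J.L t) J.N]
    rw [← hT2]
    nlinarith
  have hνν : J.G J.ν J.ν ≤ K := by
    have h := J.G_le_of_le hK hη J.ν
    rwa [J.ν_unit, mul_one] at h
  have hcK : c ≤ K := by
    by_contra! h
    nlinarith
  have hκ2 : κ ^ 2 = 1 + τ + κ * s := by
    have h : κ * κ = κ * (c * (1 + τ) + s) := by rw [← hκe]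
    linear_combination h + (1 + τ) * hcκ
  have hκs : |κ * s| ≤ K * η ^ 2 := by
    rw [abs_mul, abs_of_pos hκ0]
    calc κ * |s| ≤ κ * (η * (K * (c * η))) := by gcongr; exact hsb.trans (by gcongr)
      _ = K * η ^ 2 * (c * κ) := by ring
      _ = K * η ^ 2 := by rw [hcκ, mul_one]
  obtain ⟨hκ1, hκ2'⟩ := abs_two_mul_sub_le hκ0 hκ2 (by linarith) hη0 hη hτb hκs
  refine ⟨κ, c, t, rfl, hν, hκ0.le, ?_, hκ1, hκ2', ?_, ?_, ?_⟩
  · have := (le_abs_self _).trans hκ1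
    nlinarith
  · have h : c - 1 = c * (1 - κ) := by linear_combination hcκ
    rw [h, abs_mul, abs_of_pos hc, abs_sub_comm]
    calc c * |κ - 1| ≤ K * ((1 + K) * η) := by gcongr
      _ = _ := by ring
  · refine hTb.trans ?_
    calc K * (c * η) ≤ K * (K * η) := by gcongr
      _ = _ := by ring
  · rw [Real.sqrt_le_left (by linarith)]
    nlinarith

theorem abs_curvatureRemainder_le : |J.curvatureRemainder| ≤
    (2 * (2 + K) * (m ^ 5 * K) + 2 * (1 + 2 * K) * m + 2 * (1 + K) * m ^ 2) *
      (J.normA * J.normH ^ 2) := by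
  obtain ⟨κ, c, t, hκ, -, hκ0, hκb, hκ1, hκ2, -⟩ := J.normal_expansion hK hη
  have hη0 := J.normH_nonneg
  have hK1 := J.one_le_K hK hη
  have hA0 := J.normA_nonneg
  have h1 : J.curvatureRemainder =
      2 * κ * ∑ a, ∑ b, (J.invMetric - 1 + J.tangentialH) a b * J.A (J.f a) (J.f b)
      + (2 * κ - 2 - J.H J.N J.N) * ∑ a, J.A (J.f a) (J.f a)
      + 2 * (1 - κ) * ∑ a, ∑ b, J.tangentialH a b * J.A (J.f a) (J.f b) := by
    have h2 : ∑ a, J.A (J.f a) (J.f a) =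
        ∑ a, ∑ b, (1 : Matrix (Fin m) (Fin m) ℝ) a b * J.A (J.f a) (J.f b) := by
      simp [Matrix.one_apply]
    have h3 : ∑ a, ∑ b, (J.invMetric - 1 + J.tangentialH) a b * J.A (J.f a) (J.f b) =
        ∑ a, ∑ b, J.invMetric a b * J.A (J.f a) (J.f b)
        - ∑ a, ∑ b, (1 : Matrix (Fin m) (Fin m) ℝ) a b * J.A (J.f a) (J.f b)
        + ∑ a, ∑ b, J.tangentialH a b * J.A (J.f a) (J.f b) := by
      simp only [← Finset.sum_add_distrib, ← Finset.sum_sub_distrib, Matrix.add_apply,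
        Matrix.sub_apply]
      exact Finset.sum_congr rfl fun a _ => Finset.sum_congr rfl fun b _ => by ring
    rw [h3, ← h2, curvatureRemainder, J.sum_fg, ← hκ]
    simp only [tangentialH]
    ring
  have b1 := abs_sum_sum_mul_le _ _ (J.abs_invMetric_sub_one_add_le hK hη) J.abs_A_le
  have b2 := abs_sum_le_mul _ fun a => J.abs_A_le a a
  have b3 := abs_sum_sum_mul_le _ _ J.abs_tangentialH_le J.abs_A_le
  rw [abs_sub_comm] at hκ1
  rw [h1]
  calc _ ≤ 2 * (2 + K) * (m * (m * (m * (J.normH * (m * (J.normH * (m * K)))) * J.normA)))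
        + 2 * ((1 + 2 * K) * J.normH ^ 2) * (m * J.normA)
        + 2 * ((1 + K) * J.normH) * (m * (m * (J.normH * J.normA))) := by
        refine (abs_add_three _ _ _).trans ?_
        simp only [abs_mul, abs_two, abs_of_nonneg hκ0]
        gcongr
    _ = _ := by ring

theorem abs_derivativeRemainder_le : |J.derivativeRemainder| ≤
    (3 * m * ((1 + K) * K + K ^ 2) + 3 * m ^ 4 * K ^ 2) * (J.normNablaH * J.normH) := by
  obtain ⟨κ, c, t, -, hν, -, -, -, -, hc, ht, hνb⟩ := J.normal_expansion hK hη
  have hη0 := J.normH_nonneg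
  have hδ0 := J.normNablaH_nonneg
  have hK1 := J.one_le_K hK hη
  -- the bilinear form whose contractions are compared, for a normal argument `w`
  let T : V → W →ₗ[ℝ] W →ₗ[ℝ] ℝ := fun w =>
    (2 : ℝ) • (((flipLast J.nablaH).flip w)).compl₁₂ J.L J.L - (J.nablaH w).compl₁₂ J.L J.L
  have hT : ∀ w v v', T w v v' =
      2 * J.nablaH (J.L v) (J.L v') w - J.nablaH w (J.L v) (J.L v') := fun _ _ _ => rfl
  have hTb : ∀ w a b, |T w (J.f a) (J.f b)| ≤ 3 * J.normNablaH * √(J.G w w) := fun w a b => by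
    have h1 := J.abs_nablaH_le (J.L (J.f a)) (J.L (J.f b)) w
    have h2 := J.abs_nablaH_le w (J.L (J.f a)) (J.L (J.f b))
    simp only [G_f_self, Real.sqrt_one, mul_one] at h1 h2
    rw [hT]
    refine (abs_sub _ _).trans ?_
    rw [abs_mul, abs_two]
    linarith
  have h1 : J.derivativeRemainder = (∑ a, -((c - 1) * T J.N (J.f a) (J.f a) +
      T (J.L t) (J.f a) (J.f a)))
      - ∑ a, ∑ b, (J.invMetric - 1) a b * T J.ν (J.f a) (J.f b) := by
    have h2 : ∑ a, ∑ b, (J.invMetric - 1) a b * T J.ν (J.f a) (J.f b) =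
        ∑ c, T J.ν (J.fg c) (J.fg c) - ∑ a, T J.ν (J.f a) (J.f a) := by
      rw [J.sum_fg]
      simp [Matrix.sub_apply, sub_mul, Matrix.one_apply]
    have h3 : ∀ a, T J.ν (J.f a) (J.f a) = c * T J.N (J.f a) (J.f a) +
        T (J.L t) (J.f a) (J.f a) := fun a => by
      simp only [hT]
      rw [hν]
      simp only [map_add, map_smul, LinearMap.add_apply, LinearMap.smul_apply, smul_eq_mul]
      ring
    have h4 : ∀ a, -((c - 1) * T J.N (J.f a) (J.f a) + T (J.L t) (J.f a) (J.f a)) =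
        T J.N (J.f a) (J.f a) - T J.ν (J.f a) (J.f a) := fun a => by
      rw [h3]
      ring
    rw [h2, Finset.sum_congr rfl fun a _ => h4 a, derivativeRemainder]
    simp only [← hT, Finset.sum_sub_distrib]
    ring
  have b1 := abs_sum_le_mul (fun a => -((c - 1) * T J.N (J.f a) (J.f a) +
      T (J.L t) (J.f a) (J.f a))) (C := (1 + K) * K * J.normH * (3 * J.normNablaH) +
      3 * J.normNablaH * (K ^ 2 * J.normH)) fun a => by
    rw [abs_neg]
    refine (abs_add_le _ _).trans ?_
    rw [abs_mul]
    have h2 := hTb J.N a a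
    rw [J.N_unit, Real.sqrt_one, mul_one] at h2
    have h3 := hTb (J.L t) a a
    gcongr
    exact h3.trans (by gcongr)
  have b2 := abs_sum_sum_mul_le _ _ (J.abs_invMetric_sub_one_le hK hη)
    fun a b => (hTb J.ν a b).trans (by gcongr : _ ≤ 3 * J.normNablaH * K)
  rw [h1]
  refine (abs_sub _ _).trans ((add_le_add b1 b2).trans_eq ?_)
  ring

end

end HypersurfaceJet

/-! ### Coordinate expressions of tensor fields -/

theorem differentiableAt_clm_of_apply {D E F : Type*} [NormedAddCommGroup D] [NormedSpace ℝ D]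
    [NormedAddCommGroup E] [NormedSpace ℝ E] [FiniteDimensional ℝ E] [NormedAddCommGroup F]
    [NormedSpace ℝ F] {f : D → E →L[ℝ] F} {x : D} (h : ∀ v, DifferentiableAt ℝ (fun y => f y v) x) :
    DifferentiableAt ℝ f x := by
  let d := Module.finrank ℝ E
  have hd : d = Module.finrank ℝ (Fin d → ℝ) := (Module.finrank_fin_fun ℝ).symm
  let e₁ := ContinuousLinearEquiv.ofFinrankEq hd
  let e₂ := (e₁.arrowCongr (1 : F ≃L[ℝ] F)).trans (ContinuousLinearEquiv.piRing (Fin d))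
  rw [← Function.id_comp f, ← e₂.symm_comp_self]
  exact e₂.symm.differentiable.differentiableAt.comp x (differentiableAt_pi.2 fun i => h _)

theorem fderiv_clm_apply₂ {D E F G : Type*} [NormedAddCommGroup D] [NormedSpace ℝ D]
    [NormedAddCommGroup E] [NormedSpace ℝ E] [NormedAddCommGroup F] [NormedSpace ℝ F]
    [NormedAddCommGroup G] [NormedSpace ℝ G] {f : D → E →L[ℝ] F →L[ℝ] G} {x : D}
    (h : DifferentiableAt ℝ f x) (v : D) (a : E) (b : F) :
    fderiv ℝ (fun y => f y a b) x v = fderiv ℝ f x v a b := by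
  have h1 := (h.hasFDerivAt.clm_apply (hasFDerivAt_const a x)).clm_apply (hasFDerivAt_const b x)
  rw [h1.fderiv]
  simp

section Coordinates

variable {n : ℕ} {M : Type*} [TopologicalSpace M] [ChartedSpace (EuclideanSpace ℝ (Fin n)) M]

/-- The components of the tensor field `h` in the preferred chart at `x`. -/
def tensorCoord (h : TwoTensor n M) (x : M) (u : EuclideanSpace ℝ (Fin n)) :
    EuclideanSpace ℝ (Fin n) →L[ℝ] EuclideanSpace ℝ (Fin n) →L[ℝ] ℝ :=
  let B : EuclideanSpace ℝ (Fin n) →L[ℝ] EuclideanSpace ℝ (Fin n) →L[ℝ] ℝ :=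
    h ((extChartAt (𝓡 n) x).symm u)
  let D : EuclideanSpace ℝ (Fin n) →L[ℝ] EuclideanSpace ℝ (Fin n) :=
    mfderiv 𝓘(ℝ, EuclideanSpace ℝ (Fin n)) (𝓡 n) (extChartAt (𝓡 n) x).symm u
  B.bilinearComp D D

theorem partialTensor_eq {h : TwoTensor n M} {x : M}
    (hd : DifferentiableAt ℝ (tensorCoord h x) (extChartAt (𝓡 n) x x))
    (v a b : TangentSpace (𝓡 n) x) :
    partialTensor h x v a b = fderiv ℝ (tensorCoord h x) (extChartAt (𝓡 n) x x) v a b :=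
  fderiv_clm_apply₂ hd v a b

variable [IsManifold (𝓡 n) ∞ M]

theorem isInvertible_mfderiv_symm {x : M} {u : EuclideanSpace ℝ (Fin n)}
    (hu : u ∈ (extChartAt (𝓡 n) x).target) :
    (mfderiv 𝓘(ℝ, EuclideanSpace ℝ (Fin n)) (𝓡 n) (extChartAt (𝓡 n) x).symm u).IsInvertible := by
  have : IsManifold (𝓡 n) 1 M := .of_le (n := ∞) (by simp)
  have h := isInvertible_mfderivWithin_extChartAt_symm (I := 𝓡 n) hu
  rwa [ModelWithCorners.range_eq_univ, mfderivWithin_univ] at h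

theorem mfderiv_symm_self (x : M) :
    mfderiv 𝓘(ℝ, EuclideanSpace ℝ (Fin n)) (𝓡 n) (extChartAt (𝓡 n) x).symm
      (extChartAt (𝓡 n) x x) = ContinuousLinearMap.id ℝ (EuclideanSpace ℝ (Fin n)) := by
  have : IsManifold (𝓡 n) 1 M := .of_le (n := ∞) (by simp)
  have h := mfderivWithin_range_extChartAt_symm (I := 𝓡 n) (x := x)
  rwa [ModelWithCorners.range_eq_univ, mfderivWithin_univ] at h

theorem tensorCoord_self (h : TwoTensor n M) (x : M) (a b : EuclideanSpace ℝ (Fin n)) :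
    tensorCoord h x (extChartAt (𝓡 n) x x) a b = h x a b := by
  have h1 : ∀ y, y = x → ∀ D : EuclideanSpace ℝ (Fin n) →L[ℝ] EuclideanSpace ℝ (Fin n),
      D = ContinuousLinearMap.id ℝ _ →
      ((h y : EuclideanSpace ℝ (Fin n) →L[ℝ] EuclideanSpace ℝ (Fin n) →L[ℝ] ℝ).bilinearComp D D)
        a b = h x a b := by
    rintro y rfl D rfl
    rfl
  exact h1 _ (extChartAt_to_inv x) _ (mfderiv_symm_self x)

theorem mdifferentiableAt_extChartAt_symm {x : M} {u : EuclideanSpace ℝ (Fin n)}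
    (hu : u ∈ (extChartAt (𝓡 n) x).target) :
    MDifferentiableAt 𝓘(ℝ, EuclideanSpace ℝ (Fin n)) (𝓡 n) (extChartAt (𝓡 n) x).symm u := by
  have : IsManifold (𝓡 n) 1 M := .of_le (n := ∞) (by simp)
  have h := mdifferentiableWithinAt_extChartAt_symm (I := 𝓡 n) hu
  rwa [ModelWithCorners.range_eq_univ, mdifferentiableWithinAt_univ] at h

theorem differentiableAt_tensorCoord (g : Metric n M) (x : M) :
    DifferentiableAt ℝ (tensorCoord g.inner x) (extChartAt (𝓡 n) x x) := by
  have : IsManifold (𝓡 n) 1 M := .of_le (n := ∞) (by simp)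
  refine differentiableAt_clm_of_apply fun a => differentiableAt_clm_of_apply fun b => ?_
  -- the coordinate fields of the chart are smooth
  let σ : EuclideanSpace ℝ (Fin n) → (y : M) → TangentSpace (𝓡 n) y := fun a y =>
    (trivializationAt (EuclideanSpace ℝ (Fin n)) (TangentSpace (𝓡 n)) x).symmL ℝ y a
  have hσ : ∀ a, ContMDiffAt (𝓡 n) (𝓡 n).tangent ∞
      (fun y => (⟨y, σ a y⟩ : TangentBundle (𝓡 n) M)) x := fun a => by
    rw [contMDiffAt_section]
    refine (contMDiffAt_const (c := a)).congr_of_eventuallyEq ?_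
    filter_upwards [(chartAt (EuclideanSpace ℝ (Fin n)) x).open_source.mem_nhds
      (mem_chart_source _ x)] with y hy
    simp only [σ]
    rw [Trivialization.symmL_apply _ hy]
    exact congrArg Prod.snd ((trivializationAt (EuclideanSpace ℝ (Fin n)) (TangentSpace (𝓡 n))
      x).apply_mk_symm hy a)
  have hs : ContMDiffAt (𝓡 n) 𝓘(ℝ, ℝ) ∞ (fun y => g.inner y (σ a y) (σ b y)) x := by
    have h := ContMDiffAt.clm_bundle_apply₂ (F₁ := EuclideanSpace ℝ (Fin n))
      (F₂ := EuclideanSpace ℝ (Fin n)) (F₃ := ℝ) (E₃ := Bundle.Trivial M ℝ)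
      (g.contMDiff x) (hσ a) (hσ b)
    rw [contMDiffAt_totalSpace] at h
    exact h.2
  have hd := hs.mdifferentiableAt (by simp)
  have hd2 : MDifferentiableAt (𝓡 n) 𝓘(ℝ, ℝ) (fun y => g.inner y (σ a y) (σ b y))
      ((extChartAt (𝓡 n) x).symm (extChartAt (𝓡 n) x x)) := by rwa [extChartAt_to_inv]
  have hd3 := (hd2.comp _ (mdifferentiableAt_extChartAt_symm
    (mem_extChartAt_target (I := 𝓡 n) x))).differentiableAt
  refine hd3.congr_of_eventuallyEq ?_
  filter_upwards [extChartAt_target_mem_nhds (I := 𝓡 n) x] with u hu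
  have hD : (trivializationAt (EuclideanSpace ℝ (Fin n)) (TangentSpace (𝓡 n)) x).symmL ℝ
      ((extChartAt (𝓡 n) x).symm u) =
      mfderiv 𝓘(ℝ, EuclideanSpace ℝ (Fin n)) (𝓡 n) (extChartAt (𝓡 n) x).symm u := by
    have hs : (extChartAt (𝓡 n) x).symm u ∈ (chartAt (EuclideanSpace ℝ (Fin n)) x).source := by
      rw [← extChartAt_source (𝓡 n)]
      exact (extChartAt (𝓡 n) x).map_target hu
    rw [TangentBundle.symmL_trivializationAt hs, (extChartAt (𝓡 n) x).right_inv hu,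
      ModelWithCorners.range_eq_univ, mfderivWithin_univ]
  simp only [Function.comp_apply, σ]
  rw [hD]
  rfl

end Coordinates

/-! ### Bilinear forms and Christoffel symbols -/

section Bilinear

variable {E : Type*} [NormedAddCommGroup E] [NormedSpace ℝ E]

/-- A continuous bilinear form as a bilinear form. -/
def bilin (T : E →L[ℝ] E →L[ℝ] ℝ) : E →ₗ[ℝ] E →ₗ[ℝ] ℝ :=
  LinearMap.mk₂ ℝ (fun a b => T a b) (by simp) (by simp) (by simp) (by simp)

theorem bilin_apply (T : E →L[ℝ] E →L[ℝ] ℝ) (a b : E) : bilin T a b = T a b := rfl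

/-- A continuous trilinear form as a trilinear form. -/
def trilin (T : E →L[ℝ] E →L[ℝ] E →L[ℝ] ℝ) : E →ₗ[ℝ] E →ₗ[ℝ] E →ₗ[ℝ] ℝ where
  toFun v := bilin (T v)
  map_add' v w := by
    ext a b
    change T (v + w) a b = T v a b + T w a b
    rw [T.map_add]
    rfl
  map_smul' c v := by
    ext a b
    change T (c • v) a b = c * T v a b
    rw [T.map_smul]
    rfl

theorem trilin_apply (T : E →L[ℝ] E →L[ℝ] E →L[ℝ] ℝ) (v a b : E) : trilin T v a b = T v a b := rfl

theorem isInvertible_of_pos [FiniteDimensional ℝ E] {T : E →L[ℝ] E →L[ℝ] ℝ}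
    (h : ∀ v, v ≠ 0 → 0 < T v v) : T.IsInvertible := by
  have hinj : Function.Injective T := by
    rw [injective_iff_map_eq_zero]
    intro v hv
    by_contra hv0
    have := h v hv0
    rw [hv] at this
    simp at this
  have hfin : Module.finrank ℝ E = Module.finrank ℝ (E →L[ℝ] ℝ) := by
    rw [← Subspace.dual_finrank_eq (K := ℝ) (V := E)]
    exact (LinearMap.toContinuousLinearMap : (E →ₗ[ℝ] ℝ) ≃ₗ[ℝ] (E →L[ℝ] ℝ)).finrank_eq
  let e := (LinearMap.linearEquivOfInjective (T : E →ₗ[ℝ] E →L[ℝ] ℝ) hinj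
    hfin).toContinuousLinearEquiv
  refine ⟨e, ?_⟩
  ext v
  simp [e]

end Bilinear

section LeviCivita

variable {V : Type*} [AddCommGroup V] [Module ℝ V] {k : ℕ}

/-- The Christoffel symbols of a metric with first derivative `D` and orthonormal frame `e`. -/
def leviCivita (D : V →ₗ[ℝ] V →ₗ[ℝ] V →ₗ[ℝ] ℝ) (e : Fin k → V) : V →ₗ[ℝ] V →ₗ[ℝ] V :=
  LinearMap.mk₂ ℝ (fun v w => ∑ i, ((1 / 2 : ℝ) * (D v w (e i) + D w v (e i) - D (e i) v w)) • e i)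
    (fun u v w => by
      rw [← Finset.sum_add_distrib]
      refine Finset.sum_congr rfl fun i _ => ?_
      rw [← add_smul]
      congr 1
      simp only [map_add, LinearMap.add_apply]
      ring)
    (fun c v w => by
      rw [Finset.smul_sum]
      refine Finset.sum_congr rfl fun i _ => ?_
      rw [smul_smul]
      congr 1
      simp only [map_smul, LinearMap.smul_apply, smul_eq_mul]
      ring)
    (fun u v w => by
      rw [← Finset.sum_add_distrib]
      refine Finset.sum_congr rfl fun i _ => ?_
      rw [← add_smul]
      congr 1
      simp only [map_add, LinearMap.add_apply]
      ring)
    (fun c v w => by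
      rw [Finset.smul_sum]
      refine Finset.sum_congr rfl fun i _ => ?_
      rw [smul_smul]
      congr 1
      simp only [map_smul, LinearMap.smul_apply, smul_eq_mul]
      ring)

variable [FiniteDimensional ℝ V] {B : V →ₗ[ℝ] V →ₗ[ℝ] ℝ} {e : Fin k → V}

/-- The Koszul formula. -/
theorem IsOrthonormalFrame.koszul (he : IsOrthonormalFrame (fun v w => B v w) e)
    (hk : Module.finrank ℝ V = k) (D : V →ₗ[ℝ] V →ₗ[ℝ] V →ₗ[ℝ] ℝ) (u v w : V) :
    2 * B (leviCivita D e u v) w = D u v w + D v u w - D w u v := by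
  have h := he.inner_dual hk ((1 / 2 : ℝ) • (D u v + D v u - (D.flip u).flip v)) w
  have h2 : leviCivita D e u v =
      ∑ i, ((1 / 2 : ℝ) • (D u v + D v u - (D.flip u).flip v)) (e i) • e i := rfl
  rw [h2, h]
  simp only [LinearMap.smul_apply, LinearMap.add_apply, LinearMap.sub_apply, LinearMap.flip_apply,
    smul_eq_mul]
  ring

theorem IsOrthonormalFrame.leviCivita_metric (he : IsOrthonormalFrame (fun v w => B v w) e)
    (hk : Module.finrank ℝ V = k) (hB : ∀ v w, B v w = B w v)
    {D : V →ₗ[ℝ] V →ₗ[ℝ] V →ₗ[ℝ] ℝ} (hD : ∀ u v w, D u v w = D u w v) (u v w : V) :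
    D u v w = B (leviCivita D e u v) w + B v (leviCivita D e u w) := by
  have h1 := he.koszul hk D u v w
  have h2 := he.koszul hk D u w v
  rw [hB (leviCivita D e u w)] at h2
  linarith [hD u v w, hD v u w, hD w u v]

/-- The derivative of the trace is the trace of the covariant derivative: here `K` is `h` with one
index raised and `K'` its derivative. -/
theorem IsOrthonormalFrame.trace_derivative (he : IsOrthonormalFrame (fun v w => B v w) e)
    (hk : Module.finrank ℝ V = k) (hB : ∀ v w, B v w = B w v)
    {D : V →ₗ[ℝ] V →ₗ[ℝ] V →ₗ[ℝ] ℝ} (hD : ∀ u v w, D u v w = D u w v)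
    {H DH : V →ₗ[ℝ] V →ₗ[ℝ] ℝ} {K K' : V →ₗ[ℝ] V} {u : V}
    (hK : ∀ v w, B (K v) w = H v w) (hK' : ∀ v w, D u (K v) w + B (K' v) w = DH v w) :
    LinearMap.trace ℝ V K' = ∑ i, (DH (e i) (e i) - H (leviCivita D e u (e i)) (e i)
      - H (e i) (leviCivita D e u (e i))) := by
  have h1 : ∑ i, B (leviCivita D e u (K (e i))) (e i) =
      ∑ i, B (K (leviCivita D e u (e i))) (e i) := by
    have h := LinearMap.trace_mul_comm ℝ (leviCivita D e u) K
    rw [he.trace_eq hk, he.trace_eq hk] at h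
    exact h
  have h2 : ∀ i, B (K' (e i)) (e i) = DH (e i) (e i) - B (leviCivita D e u (K (e i))) (e i)
      - H (e i) (leviCivita D e u (e i)) := fun i => by
    have h := he.leviCivita_metric hk hB hD u (K (e i)) (e i)
    rw [hK] at h
    linarith [hK' (e i) (e i)]
  rw [he.trace_eq hk, Finset.sum_congr rfl fun i _ => h2 i]
  simp only [Finset.sum_sub_distrib, h1, hK]

end LeviCivita

/-! ### The Levi-Civita connection and the trace in coordinates -/

section LeviCivitaCoord

variable {n : ℕ} {M : Type*} [TopologicalSpace M] [ChartedSpace (EuclideanSpace ℝ (Fin n)) M]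

/-- The value at `x` of a tensor field, as a bilinear form on the model space. -/
def tensorVal (h : TwoTensor n M) (x : M) :
    EuclideanSpace ℝ (Fin n) →ₗ[ℝ] EuclideanSpace ℝ (Fin n) →ₗ[ℝ] ℝ :=
  bilin (E := EuclideanSpace ℝ (Fin n)) (h x)

set_option maxSynthPendingDepth 3 in
/-- The first partial derivatives at `x` of a tensor field in the preferred chart at `x`. -/
def tensorDeriv (h : TwoTensor n M) (x : M) : EuclideanSpace ℝ (Fin n) →ₗ[ℝ]
    EuclideanSpace ℝ (Fin n) →ₗ[ℝ] EuclideanSpace ℝ (Fin n) →ₗ[ℝ] ℝ :=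
  trilin (E := EuclideanSpace ℝ (Fin n)) (fderiv ℝ (tensorCoord h x) (extChartAt (𝓡 n) x x))

variable {g h : TwoTensor n M} {x : M}

theorem tensorDeriv_apply (hd : DifferentiableAt ℝ (tensorCoord h x) (extChartAt (𝓡 n) x x))
    (v a b : TangentSpace (𝓡 n) x) : partialTensor h x v a b = tensorDeriv h x v a b :=
  partialTensor_eq hd v a b

theorem christoffel_eq (hd : DifferentiableAt ℝ (tensorCoord g x) (extChartAt (𝓡 n) x x))
    (v w : TangentSpace (𝓡 n) x) :
    christoffel g x v w = leviCivita (tensorDeriv g x) (frame g x) v w := by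
  simp only [christoffel, tensorDeriv_apply hd]
  rfl

theorem covDerivTensor_eq (hg : DifferentiableAt ℝ (tensorCoord g x) (extChartAt (𝓡 n) x x))
    (hh : DifferentiableAt ℝ (tensorCoord h x) (extChartAt (𝓡 n) x x))
    (v a b : TangentSpace (𝓡 n) x) : covDerivTensor g h x v a b =
      tensorDeriv h x v a b - tensorVal h x (leviCivita (tensorDeriv g x) (frame g x) v a) b
        - tensorVal h x a (leviCivita (tensorDeriv g x) (frame g x) v b) := by
  rw [covDerivTensor, tensorDeriv_apply hh, christoffel_eq hg, christoffel_eq hg]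
  rfl

theorem tensorDeriv_symm (hs : ∀ y v w, h y v w = h y w v)
    (hd : DifferentiableAt ℝ (tensorCoord h x) (extChartAt (𝓡 n) x x))
    (u v w : EuclideanSpace ℝ (Fin n)) : tensorDeriv h x u v w = tensorDeriv h x u w v := by
  have h1 : (fun y => tensorCoord h x y v w) = fun y => tensorCoord h x y w v :=
    funext fun y => hs _ _ _
  rw [tensorDeriv, trilin_apply, trilin_apply, ← fderiv_clm_apply₂ hd, ← fderiv_clm_apply₂ hd, h1]

theorem isOrthonormalFrame_frame (hs : ∀ y v w, g y v w = g y w v)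
    (hp : ∀ y v, v ≠ 0 → 0 < g y v v) (x : M) :
    IsOrthonormalFrame (fun v w => tensorVal g x v w) (frame g x) :=
  isOrthonormalFrame_orthonormalFrame (V := EuclideanSpace ℝ (Fin n)) finrank_euclideanSpace_fin
    (tensorVal g x) (hs x) (hp x)

variable [IsManifold (𝓡 n) ∞ M]

theorem tensorCoord_self_eq (h : TwoTensor n M) (x : M) :
    bilin (tensorCoord h x (extChartAt (𝓡 n) x x)) = tensorVal h x := by
  ext a b
  exact tensorCoord_self h x a b

theorem tensorCoord_pos (hp : ∀ y v, v ≠ 0 → 0 < g y v v) {u : EuclideanSpace ℝ (Fin n)}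
    (hu : u ∈ (extChartAt (𝓡 n) x).target) (v : EuclideanSpace ℝ (Fin n)) (hv : v ≠ 0) :
    0 < tensorCoord g x u v v := by
  refine hp _ _ fun h0 => hv ?_
  exact (isInvertible_mfderiv_symm hu).injective (h0.trans (map_zero _).symm)

/-- The field `h` with one index raised, in the preferred chart at `x`. -/
def raised (g h : TwoTensor n M) (x : M) (u : EuclideanSpace ℝ (Fin n)) :
    EuclideanSpace ℝ (Fin n) →L[ℝ] EuclideanSpace ℝ (Fin n) :=
  (tensorCoord g x u).inverse ∘L tensorCoord h x u

theorem tensorCoord_raised (hp : ∀ y v, v ≠ 0 → 0 < g y v v) {u : EuclideanSpace ℝ (Fin n)}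
    (hu : u ∈ (extChartAt (𝓡 n) x).target) (a b : EuclideanSpace ℝ (Fin n)) :
    tensorCoord g x u (raised g h x u a) b = tensorCoord h x u a b := by
  have h := (isInvertible_of_pos (tensorCoord_pos hp hu)).self_apply_inverse (tensorCoord h x u a)
  rw [raised, ContinuousLinearMap.comp_apply, h]

theorem trace_symm_eq (hs : ∀ y v w, g y v w = g y w v) (hp : ∀ y v, v ≠ 0 → 0 < g y v v)
    {u : EuclideanSpace ℝ (Fin n)} (hu : u ∈ (extChartAt (𝓡 n) x).target) :
    trace g h ((extChartAt (𝓡 n) x).symm u) =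
      LinearMap.trace ℝ (EuclideanSpace ℝ (Fin n)) (raised g h x u) := by
  have hD := isInvertible_mfderiv_symm hu
  have hfr := isOrthonormalFrame_frame hs hp ((extChartAt (𝓡 n) x).symm u)
  -- pull the frame back to the model space
  have hsurj : ∀ i, ∃ a : EuclideanSpace ℝ (Fin n),
      mfderiv 𝓘(ℝ, EuclideanSpace ℝ (Fin n)) (𝓡 n) (extChartAt (𝓡 n) x).symm u a =
        frame g ((extChartAt (𝓡 n) x).symm u) i := fun i => hD.surjective _
  choose a ha using hsurj
  have hO : IsOrthonormalFrame (fun v w => bilin (tensorCoord g x u) v w) a := fun i j => by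
    rw [← hfr i j, ← ha, ← ha]
    rfl
  rw [hO.trace_eq finrank_euclideanSpace_fin, trace]
  refine Finset.sum_congr rfl fun i _ => ?_
  refine Eq.trans ?_ (tensorCoord_raised hp hu (a i) (a i)).symm
  rw [← ha]
  rfl

/-- The differential of the trace is the trace of the covariant derivative. -/
theorem mvfderiv_trace (hs : ∀ y v w, g y v w = g y w v) (hp : ∀ y v, v ≠ 0 → 0 < g y v v)
    (hg : DifferentiableAt ℝ (tensorCoord g x) (extChartAt (𝓡 n) x x))
    (hh : DifferentiableAt ℝ (tensorCoord h x) (extChartAt (𝓡 n) x x))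
    (v : TangentSpace (𝓡 n) x) :
    mvfderiv (𝓡 n) (trace g h) x v =
      ∑ i, covDerivTensor g h x v (frame g x i) (frame g x i) := by
  have : IsManifold (𝓡 n) 1 M := .of_le (n := ∞) (by simp)
  let v' : EuclideanSpace ℝ (Fin n) := v
  set u₀ := extChartAt (𝓡 n) x x with hu₀
  have hmem : u₀ ∈ (extChartAt (𝓡 n) x).target := mem_extChartAt_target (I := 𝓡 n) x
  have hK : DifferentiableAt ℝ (raised g h x) u₀ := by
    have h1 := ((isInvertible_of_pos (tensorCoord_pos hp hmem)).contDiffAt_map_inverse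
      (n := 1)).differentiableAt one_ne_zero
    exact (h1.comp u₀ hg).clm_comp hh
  set K' := fderiv ℝ (raised g h x) u₀ v' with hK'
  have hKv : ∀ a b, tensorVal g x (raised g h x u₀ a) b = tensorVal h x a b := fun a b => by
    rw [← tensorCoord_self_eq, ← tensorCoord_self_eq]
    exact tensorCoord_raised hp hmem a b
  have hKd : ∀ a b, tensorDeriv g x v' (raised g h x u₀ a) b + tensorVal g x (K' a) b =
      tensorDeriv h x v' a b := fun a b => by
    have h1 : (fun u => tensorCoord g x u (raised g h x u a) b) =ᶠ[𝓝 u₀]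
        fun u => tensorCoord h x u a b := by
      filter_upwards [extChartAt_target_mem_nhds (I := 𝓡 n) x] with u hu
      exact tensorCoord_raised hp hu a b
    have h2 := h1.fderiv_eq (𝕜 := ℝ)
    have h3 : HasFDerivAt (fun u => raised g h x u a) _ u₀ :=
      hK.hasFDerivAt.clm_apply (hasFDerivAt_const a u₀)
    have h3 := (hg.hasFDerivAt.clm_apply h3).clm_apply (hasFDerivAt_const b u₀)
    have h4 := DFunLike.congr_fun (h3.fderiv.symm.trans h2) v'
    rw [fderiv_clm_apply₂ hh] at h4
    rw [← tensorCoord_self_eq, tensorDeriv, tensorDeriv, trilin_apply, trilin_apply, bilin_apply,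
      ← h4, ← hu₀]
    simp [hK', add_comm]
  let Tr : (EuclideanSpace ℝ (Fin n) →L[ℝ] EuclideanSpace ℝ (Fin n)) →L[ℝ] ℝ :=
    LinearMap.toContinuousLinearMap ((LinearMap.trace ℝ (EuclideanSpace ℝ (Fin n))) ∘ₗ
      ContinuousLinearMap.coeLM ℝ)
  have h1 : trace g h =ᶠ[𝓝 x] (fun u => Tr (raised g h x u)) ∘ extChartAt (𝓡 n) x := by
    filter_upwards [extChartAt_source_mem_nhds (I := 𝓡 n) x] with y hy
    have h2 := trace_symm_eq (h := h) hs hp ((extChartAt (𝓡 n) x).map_source hy)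
    rw [(extChartAt (𝓡 n) x).left_inv hy] at h2
    exact h2
  have h2 : HasFDerivAt (fun u => Tr (raised g h x u)) (Tr ∘L fderiv ℝ (raised g h x) u₀) u₀ :=
    Tr.hasFDerivAt.comp u₀ hK.hasFDerivAt
  have h3 : mvfderiv (𝓡 n) (trace g h) x v = Tr K' := by
    have h4 := (h2.hasMFDerivAt.comp x (mdifferentiableAt_extChartAt (I := 𝓡 n)
      (mem_chart_source _ x)).hasMFDerivAt).congr_of_eventuallyEq h1
    rw [mfderiv_extChartAt_self] at h4
    exact congrArg (fun T => T v) h4.mfderiv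
  rw [h3]
  have h4 := (isOrthonormalFrame_frame hs hp x).trace_derivative finrank_euclideanSpace_fin (hs x)
    (tensorDeriv_symm hs hg) (H := tensorVal h x) (DH := tensorDeriv h x v')
    (K := raised g h x u₀) (K' := K') (u := v') hKv hKd
  refine Eq.trans h4 ?_
  refine Finset.sum_congr rfl fun i _ => ?_
  rw [covDerivTensor_eq hg hh]

end LeviCivitaCoord

/-! ### The hypersurface in coordinates -/

set_option maxSynthPendingDepth 3 in
/-- The product rule for a bilinear form along a map. -/
theorem fderiv_form_comp {E F : Type*} [NormedAddCommGroup E] [NormedSpace ℝ E]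
    [NormedAddCommGroup F] [NormedSpace ℝ F] {T : E → E →L[ℝ] E →L[ℝ] ℝ} {f a b : F → E} {s : F}
    (hT : DifferentiableAt ℝ T (f s)) (hf : DifferentiableAt ℝ f s)
    (ha : DifferentiableAt ℝ a s) (hb : DifferentiableAt ℝ b s) (v : F) :
    fderiv ℝ (fun s => T (f s) (a s) (b s)) s v =
      fderiv ℝ T (f s) (fderiv ℝ f s v) (a s) (b s) + T (f s) (fderiv ℝ a s v) (b s)
        + T (f s) (a s) (fderiv ℝ b s v) := by
  have h1 : HasFDerivAt (fun s => T (f s)) (fderiv ℝ T (f s) ∘L fderiv ℝ f s) s :=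
    hT.hasFDerivAt.comp s hf.hasFDerivAt
  have h2 := (h1.clm_apply ha.hasFDerivAt).clm_apply hb.hasFDerivAt
  rw [h2.fderiv]
  simp
  ring

section HypersurfaceCoord

variable {n : ℕ} {S U : Type*}
  [TopologicalSpace S] [ChartedSpace (EuclideanSpace ℝ (Fin (n - 1))) S]
  [TopologicalSpace U] [ChartedSpace (EuclideanSpace ℝ (Fin n)) U]
  {ι : S → U} {p : S}

/-- The points of the preferred chart at `p` at which `ι` takes values in the preferred chart
at `ι p`. -/
def chartDomain (ι : S → U) (p : S) : Set (EuclideanSpace ℝ (Fin (n - 1))) :=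
  {s | s ∈ (extChartAt (𝓡 (n - 1)) p).target ∧
    ι ((extChartAt (𝓡 (n - 1)) p).symm s) ∈ (extChartAt (𝓡 n) (ι p)).source}

/-- The components of a vector field along `ι` in the preferred charts at `p` and `ι p`. -/
def normalInChart (ι : S → U) (ν : (p : S) → TangentSpace (𝓡 n) (ι p)) (p : S)
    (s : EuclideanSpace ℝ (Fin (n - 1))) : EuclideanSpace ℝ (Fin n) :=
  mfderiv (𝓡 n) 𝓘(ℝ, EuclideanSpace ℝ (Fin n)) (extChartAt (𝓡 n) (ι p))
    (ι ((extChartAt (𝓡 (n - 1)) p).symm s)) (ν ((extChartAt (𝓡 (n - 1)) p).symm s))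

variable (ι p) in
/-- The map `ι` in the preferred charts at `p` and `ι p`. -/
abbrev mapInChart : EuclideanSpace ℝ (Fin (n - 1)) → EuclideanSpace ℝ (Fin n) :=
  writtenInExtChartAt (𝓡 (n - 1)) (𝓡 n) p ι

theorem mapInChart_self : mapInChart (n := n) ι p (extChartAt (𝓡 (n - 1)) p p) =
    extChartAt (𝓡 n) (ι p) (ι p) := by
  rw [mapInChart, writtenInExtChartAt, Function.comp_apply, Function.comp_apply,
    extChartAt_to_inv]

theorem symm_mapInChart {s : EuclideanSpace ℝ (Fin (n - 1))} (hs : s ∈ chartDomain (n := n) ι p) :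
    (extChartAt (𝓡 n) (ι p)).symm (mapInChart ι p s) = ι ((extChartAt (𝓡 (n - 1)) p).symm s) :=
  (extChartAt (𝓡 n) (ι p)).left_inv hs.2

theorem mapInChart_mem {s : EuclideanSpace ℝ (Fin (n - 1))} (hs : s ∈ chartDomain (n := n) ι p) :
    mapInChart ι p s ∈ (extChartAt (𝓡 n) (ι p)).target :=
  (extChartAt (𝓡 n) (ι p)).map_source hs.2

theorem isOpen_chartDomain (hι : Continuous ι) : IsOpen (chartDomain (n := n) ι p) :=
  (continuousOn_extChartAt_symm (I := 𝓡 (n - 1)) p).isOpen_inter_preimage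
    (isOpen_extChartAt_target p) ((isOpen_extChartAt_source (I := 𝓡 n) (ι p)).preimage hι)

theorem mem_chartDomain_self : extChartAt (𝓡 (n - 1)) p p ∈ chartDomain (n := n) ι p :=
  ⟨mem_extChartAt_target p, by
    rw [extChartAt_to_inv]
    exact mem_extChartAt_source _⟩

theorem chartDomain_mem_nhds (hι : Continuous ι) {s : EuclideanSpace ℝ (Fin (n - 1))}
    (hs : s ∈ chartDomain (n := n) ι p) : chartDomain (n := n) ι p ∈ 𝓝 s :=
  (isOpen_chartDomain hι).mem_nhds hs

theorem eventually_chartDomain (hι : ContMDiff (𝓡 (n - 1)) (𝓡 n) ∞ ι) :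
    ∀ᶠ s in 𝓝 (extChartAt (𝓡 (n - 1)) p p), s ∈ chartDomain (n := n) ι p :=
  chartDomain_mem_nhds hι.continuous mem_chartDomain_self

theorem contDiffAt_mapInChart (hι : ContMDiff (𝓡 (n - 1)) (𝓡 n) ∞ ι) :
    ContDiffAt ℝ ∞ (mapInChart (n := n) ι p) (extChartAt (𝓡 (n - 1)) p p) := by
  have h := (contMDiffAt_iff.1 (hι p)).2
  rwa [ModelWithCorners.range_eq_univ, contDiffWithinAt_univ] at h

theorem push_eq (hι : ContMDiff (𝓡 (n - 1)) (𝓡 n) ∞ ι) (v : TangentSpace (𝓡 (n - 1)) p) :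
    push n ι p v = fderiv ℝ (mapInChart (n := n) ι p) (extChartAt (𝓡 (n - 1)) p p) v := by
  have h := ((hι p).mdifferentiableAt (by simp)).mfderiv
  rw [ModelWithCorners.range_eq_univ, fderivWithin_univ] at h
  exact congrArg (fun T => T v) h

variable [IsManifold (𝓡 (n - 1)) ∞ S]

theorem hasMFDerivAt_comp_symm (hι : ContMDiff (𝓡 (n - 1)) (𝓡 n) ∞ ι)
    {s : EuclideanSpace ℝ (Fin (n - 1))} (hs : s ∈ chartDomain (n := n) ι p) :
    HasMFDerivAt 𝓘(ℝ, EuclideanSpace ℝ (Fin (n - 1))) (𝓡 n)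
      (ι ∘ (extChartAt (𝓡 (n - 1)) p).symm) s
      (mfderiv (𝓡 (n - 1)) (𝓡 n) ι ((extChartAt (𝓡 (n - 1)) p).symm s) ∘L
        mfderiv 𝓘(ℝ, EuclideanSpace ℝ (Fin (n - 1))) (𝓡 (n - 1))
          (extChartAt (𝓡 (n - 1)) p).symm s) :=
  ((hι _).mdifferentiableAt (by simp)).hasMFDerivAt.comp s
    (mdifferentiableAt_extChartAt_symm hs.1).hasMFDerivAt

variable [IsManifold (𝓡 n) ∞ U]

theorem differentiableAt_mapInChart (hι : ContMDiff (𝓡 (n - 1)) (𝓡 n) ∞ ι)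
    {s : EuclideanSpace ℝ (Fin (n - 1))} (hs : s ∈ chartDomain (n := n) ι p) :
    DifferentiableAt ℝ (mapInChart (n := n) ι p) s := by
  have : IsManifold (𝓡 n) 1 U := .of_le (n := ∞) (by simp)
  have h1 : MDifferentiableAt (𝓡 n) 𝓘(ℝ, EuclideanSpace ℝ (Fin n)) (extChartAt (𝓡 n) (ι p))
      ((ι ∘ (extChartAt (𝓡 (n - 1)) p).symm) s) :=
    mdifferentiableAt_extChartAt (by
      rw [← extChartAt_source (𝓡 n)]
      exact hs.2)
  exact (h1.comp s (hasMFDerivAt_comp_symm hι hs).mdifferentiableAt).differentiableAt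

/-- The differential of `ι` in coordinates. -/
theorem mfderiv_symm_mapInChart (hι : ContMDiff (𝓡 (n - 1)) (𝓡 n) ∞ ι)
    {s : EuclideanSpace ℝ (Fin (n - 1))} (hs : s ∈ chartDomain (n := n) ι p)
    (v : EuclideanSpace ℝ (Fin (n - 1))) :
    (push n ι ((extChartAt (𝓡 (n - 1)) p).symm s)
      (mfderiv 𝓘(ℝ, EuclideanSpace ℝ (Fin (n - 1))) (𝓡 (n - 1))
        (extChartAt (𝓡 (n - 1)) p).symm s v) : EuclideanSpace ℝ (Fin n)) =
      mfderiv 𝓘(ℝ, EuclideanSpace ℝ (Fin n)) (𝓡 n) (extChartAt (𝓡 n) (ι p)).symm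
        (mapInChart ι p s) (fderiv ℝ (mapInChart (n := n) ι p) s v) := by
  have h1 := hasMFDerivAt_comp_symm hι hs
  have h2 := (mdifferentiableAt_extChartAt_symm (mapInChart_mem hs)).hasMFDerivAt.comp s
    (differentiableAt_mapInChart hι hs).hasFDerivAt.hasMFDerivAt
  have h3 : (extChartAt (𝓡 n) (ι p)).symm ∘ mapInChart ι p =ᶠ[𝓝 s]
      ι ∘ (extChartAt (𝓡 (n - 1)) p).symm := by
    filter_upwards [chartDomain_mem_nhds hι.continuous hs] with t ht
    exact symm_mapInChart ht
  exact (congrArg (fun T => T v)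
    (hasMFDerivAt_unique h2 (h1.congr_of_eventuallyEq h3))).symm

omit [IsManifold (𝓡 (n - 1)) ∞ S] [IsManifold (𝓡 n) ∞ U] in
theorem tensor_congr (g : TwoTensor n U) {x y : U} (h : x = y)
    {a a' b b' : EuclideanSpace ℝ (Fin n)} (ha : a = a') (hb : b = b') :
    tensorVal g x a b = tensorVal g y a' b' := by
  rw [h, ha, hb]

theorem tensorCoord_inducedMetric (g : TwoTensor n U) (hι : ContMDiff (𝓡 (n - 1)) (𝓡 n) ∞ ι)
    {s : EuclideanSpace ℝ (Fin (n - 1))} (hs : s ∈ chartDomain (n := n) ι p)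
    (a b : EuclideanSpace ℝ (Fin (n - 1))) :
    tensorCoord (inducedMetric g ι) p s a b =
      tensorCoord g (ι p) (mapInChart ι p s) (fderiv ℝ (mapInChart (n := n) ι p) s a)
        (fderiv ℝ (mapInChart (n := n) ι p) s b) :=
  (tensor_congr g (symm_mapInChart hs) (mfderiv_symm_mapInChart hι hs a).symm
    (mfderiv_symm_mapInChart hι hs b).symm).symm

variable {ν : (p : S) → TangentSpace (𝓡 n) (ι p)}

omit [IsManifold (𝓡 (n - 1)) ∞ S] in
theorem mfderiv_symm_normalInChart {s : EuclideanSpace ℝ (Fin (n - 1))}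
    (hs : s ∈ chartDomain (n := n) ι p) :
    (mfderiv 𝓘(ℝ, EuclideanSpace ℝ (Fin n)) (𝓡 n) (extChartAt (𝓡 n) (ι p)).symm
        (mapInChart ι p s) (normalInChart ι ν p s) : EuclideanSpace ℝ (Fin n)) =
      ν ((extChartAt (𝓡 (n - 1)) p).symm s) := by
  have : IsManifold (𝓡 n) 1 U := .of_le (n := ∞) (by simp)
  have h := mfderivWithin_extChartAt_symm_comp_mfderiv_extChartAt' (I := 𝓡 n) hs.2
  rw [ModelWithCorners.range_eq_univ, mfderivWithin_univ] at h
  exact congrArg (fun T => T (ν ((extChartAt (𝓡 (n - 1)) p).symm s))) h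

omit [IsManifold (𝓡 (n - 1)) ∞ S] in
theorem normalInChart_self : normalInChart ι ν p (extChartAt (𝓡 (n - 1)) p p) = ν p := by
  have : IsManifold (𝓡 n) 1 U := .of_le (n := ∞) (by simp)
  have h : ∀ q, q = p → (mfderiv (𝓡 n) 𝓘(ℝ, EuclideanSpace ℝ (Fin n)) (extChartAt (𝓡 n) (ι p))
      (ι q) (ν q) : EuclideanSpace ℝ (Fin n)) = ν p := by
    rintro q rfl
    rw [mfderiv_extChartAt_self]
    rfl
  exact h _ (extChartAt_to_inv p)

omit [IsManifold (𝓡 n) ∞ U] in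
/-- Smoothness along `ι` is stated in the tangent bundle, whose trivializations are the
derivatives of the charts. -/
theorem differentiableAt_normalInChart [IsManifold (𝓡 n) 1 U] (hν : IsSmoothAlong ι ν)
    (hι : ContMDiff (𝓡 (n - 1)) (𝓡 n) ∞ ι) :
    DifferentiableAt ℝ (normalInChart ι ν p) (extChartAt (𝓡 (n - 1)) p p) := by
  have h1 := (contMDiffAt_totalSpace.1 (hν p)).2.mdifferentiableAt (by simp)
  have h2 : MDifferentiableAt (𝓡 (n - 1)) 𝓘(ℝ, EuclideanSpace ℝ (Fin n))
      (fun q => (trivializationAt (EuclideanSpace ℝ (Fin n)) (TangentSpace (𝓡 n)) (ι p)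
        (⟨ι q, ν q⟩ : TangentBundle (𝓡 n) U)).2)
      ((extChartAt (𝓡 (n - 1)) p).symm (extChartAt (𝓡 (n - 1)) p p)) := by
    rwa [extChartAt_to_inv]
  have h3 := (h2.comp _ (mdifferentiableAt_extChartAt_symm
    (mem_extChartAt_target (I := 𝓡 (n - 1)) p))).differentiableAt
  refine h3.congr_of_eventuallyEq ?_
  filter_upwards [eventually_chartDomain hι] with s hs
  have h4 : ι ((extChartAt (𝓡 (n - 1)) p).symm s) ∈
      (chartAt (EuclideanSpace ℝ (Fin n)) (ι p)).source := by
    rw [← extChartAt_source (𝓡 n)]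
    exact hs.2
  have h5 : (trivializationAt (EuclideanSpace ℝ (Fin n)) (TangentSpace (𝓡 n))
      (ι p)).continuousLinearMapAt ℝ (ι ((extChartAt (𝓡 (n - 1)) p).symm s))
        (ν ((extChartAt (𝓡 (n - 1)) p).symm s)) =
      (trivializationAt (EuclideanSpace ℝ (Fin n)) (TangentSpace (𝓡 n)) (ι p)
        (⟨_, ν ((extChartAt (𝓡 (n - 1)) p).symm s)⟩ : TangentBundle (𝓡 n) U)).2 := by
    rw [Trivialization.continuousLinearMapAt_apply, Trivialization.linearMapAt_apply]
    exact if_pos h4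
  exact (congrArg (fun T => T (ν ((extChartAt (𝓡 (n - 1)) p).symm s)))
    (TangentBundle.continuousLinearMapAt_trivializationAt h4).symm).trans h5

end HypersurfaceCoord

/-! ### Derivatives of the induced metric, the normal and the dual field -/

set_option maxSynthPendingDepth 3 in
theorem differentiableAt_inverse_apply {E F G : Type*} [NormedAddCommGroup E] [NormedSpace ℝ E]
    [CompleteSpace E] [NormedAddCommGroup F] [NormedSpace ℝ F] [NormedAddCommGroup G]
    [NormedSpace ℝ G] {T : G → E →L[ℝ] F} {α : G → F} {s : G} (hs : (T s).IsInvertible)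
    (hT : DifferentiableAt ℝ T s) (hα : DifferentiableAt ℝ α s) :
    DifferentiableAt ℝ (fun s => (T s).inverse (α s)) s :=
  (((hs.contDiffAt_map_inverse (n := 1)).differentiableAt one_ne_zero).comp s hT).clm_apply hα

theorem differentiableAt_clm_comp {E F G : Type*} [NormedAddCommGroup E] [NormedSpace ℝ E]
    [NormedAddCommGroup F] [NormedSpace ℝ F] [NormedAddCommGroup G]
    [NormedSpace ℝ G] {α : G → F →L[ℝ] ℝ} {T : G → E →L[ℝ] F} {s : G}
    (hα : DifferentiableAt ℝ α s) (hT : DifferentiableAt ℝ T s) :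
    DifferentiableAt ℝ (fun s => (α s) ∘L (T s)) s :=
  hα.clm_comp hT

section Jet

variable {n : ℕ} {S U : Type*}
  [TopologicalSpace S] [ChartedSpace (EuclideanSpace ℝ (Fin (n - 1))) S]
  [TopologicalSpace U] [ChartedSpace (EuclideanSpace ℝ (Fin n)) U]
  {ι : S → U} {p : S} {g h : TwoTensor n U} {ν : (p : S) → TangentSpace (𝓡 n) (ι p)}

/-- The differential of `ι` at `p`, as a linear map between the model spaces. -/
def pushLin (n : ℕ) {S U : Type*}
    [TopologicalSpace S] [ChartedSpace (EuclideanSpace ℝ (Fin (n - 1))) S]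
    [TopologicalSpace U] [ChartedSpace (EuclideanSpace ℝ (Fin n)) U] (ι : S → U) (p : S) :
    EuclideanSpace ℝ (Fin (n - 1)) →ₗ[ℝ] EuclideanSpace ℝ (Fin n) :=
  let L : EuclideanSpace ℝ (Fin (n - 1)) →L[ℝ] EuclideanSpace ℝ (Fin n) :=
    mfderiv (𝓡 (n - 1)) (𝓡 n) ι p
  L

theorem inducedMetric_symm (hs : ∀ y v w, g y v w = g y w v) (q : S)
    (v w : TangentSpace (𝓡 (n - 1)) q) : inducedMetric g ι q v w = inducedMetric g ι q w v :=
  hs _ _ _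

theorem inducedMetric_pos (hp : ∀ y v, v ≠ 0 → 0 < g y v v) (hι : IsSmoothImmersion n ι) (q : S)
    (v : TangentSpace (𝓡 (n - 1)) q) (hv : v ≠ 0) : 0 < inducedMetric g ι q v v :=
  hp _ _ fun h0 => hv (hι.2 q (h0.trans (map_zero (pushLin n ι q)).symm))

theorem tangentialDual_apply (hs : ∀ y v w, g y v w = g y w v) (hp : ∀ y v, v ≠ 0 → 0 < g y v v)
    (hι : IsSmoothImmersion n ι) (q : S) (w : EuclideanSpace ℝ (Fin (n - 1))) :
    tensorVal (inducedMetric g ι) q (tangentialDual g h ι ν q) w =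
      tensorVal h (ι q) (ν q) (pushLin n ι q w) :=
  (isOrthonormalFrame_frame (inducedMetric_symm hs) (inducedMetric_pos hp hι) q).inner_dual
    finrank_euclideanSpace_fin (tensorVal h (ι q) (ν q) ∘ₗ pushLin n ι q) w

theorem pushLin_eq (hι : ContMDiff (𝓡 (n - 1)) (𝓡 n) ∞ ι) (v : EuclideanSpace ℝ (Fin (n - 1))) :
    pushLin n ι p v = fderiv ℝ (mapInChart (n := n) ι p) (extChartAt (𝓡 (n - 1)) p p) v :=
  push_eq hι v

set_option maxSynthPendingDepth 3 in
/-- The second derivative at `p` of `ι` in coordinates. -/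
def secondDeriv (n : ℕ) {S U : Type*}
    [TopologicalSpace S] [ChartedSpace (EuclideanSpace ℝ (Fin (n - 1))) S]
    [TopologicalSpace U] [ChartedSpace (EuclideanSpace ℝ (Fin n)) U] (ι : S → U) (p : S) :
    EuclideanSpace ℝ (Fin (n - 1)) →ₗ[ℝ] EuclideanSpace ℝ (Fin (n - 1)) →ₗ[ℝ]
      EuclideanSpace ℝ (Fin n) :=
  LinearMap.mk₂ ℝ (fun v w => fderiv ℝ (fderiv ℝ (mapInChart (n := n) ι p))
    (extChartAt (𝓡 (n - 1)) p p) v w) (by simp) (by simp) (by simp) (by simp)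

theorem secondDeriv_apply (v w : EuclideanSpace ℝ (Fin (n - 1))) :
    secondDeriv n ι p v w = fderiv ℝ (fderiv ℝ (mapInChart (n := n) ι p))
      (extChartAt (𝓡 (n - 1)) p p) v w := rfl

theorem secondDeriv_symm (hι : ContMDiff (𝓡 (n - 1)) (𝓡 n) ∞ ι)
    (v w : EuclideanSpace ℝ (Fin (n - 1))) : secondDeriv n ι p v w = secondDeriv n ι p w v :=
  ((contDiffAt_mapInChart (p := p) hι).isSymmSndFDerivAt
    (by simp [minSmoothness_of_isRCLikeNormedField]; exact ENat.LEInfty.out)) v w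

theorem differentiableAt_fderiv_mapInChart (hι : ContMDiff (𝓡 (n - 1)) (𝓡 n) ∞ ι) :
    DifferentiableAt ℝ (fderiv ℝ (mapInChart (n := n) ι p)) (extChartAt (𝓡 (n - 1)) p p) :=
  ((contDiffAt_mapInChart (p := p) hι).fderiv_right (m := 1)
    (by rw [one_add_one_eq_two]; exact ENat.LEInfty.out)).differentiableAt one_ne_zero

theorem differentiableAt_fderiv_apply_and (hι : ContMDiff (𝓡 (n - 1)) (𝓡 n) ∞ ι)
    (a v : EuclideanSpace ℝ (Fin (n - 1))) :
    DifferentiableAt ℝ (fun s => fderiv ℝ (mapInChart (n := n) ι p) s a)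
      (extChartAt (𝓡 (n - 1)) p p) ∧
    fderiv ℝ (fun s => fderiv ℝ (mapInChart (n := n) ι p) s a) (extChartAt (𝓡 (n - 1)) p p) v =
      secondDeriv n ι p v a := by
  have h : HasFDerivAt (fun s => fderiv ℝ (mapInChart (n := n) ι p) s a) _
      (extChartAt (𝓡 (n - 1)) p p) :=
    (differentiableAt_fderiv_mapInChart hι).hasFDerivAt.clm_apply (hasFDerivAt_const a _)
  refine ⟨h.differentiableAt, ?_⟩
  rw [h.fderiv, secondDeriv_apply]
  simp

variable [IsManifold (𝓡 n) ∞ U]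

/-- The product rule for a tensor field contracted with two vector fields along `ι`. -/
theorem fderiv_tensorCoord_comp
    (hd : DifferentiableAt ℝ (tensorCoord g (ι p)) (extChartAt (𝓡 n) (ι p) (ι p)))
    (hι : ContMDiff (𝓡 (n - 1)) (𝓡 n) ∞ ι)
    {a b : EuclideanSpace ℝ (Fin (n - 1)) → EuclideanSpace ℝ (Fin n)}
    (ha : DifferentiableAt ℝ a (extChartAt (𝓡 (n - 1)) p p))
    (hb : DifferentiableAt ℝ b (extChartAt (𝓡 (n - 1)) p p))
    (v : EuclideanSpace ℝ (Fin (n - 1))) :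
    fderiv ℝ (fun s => tensorCoord g (ι p) (mapInChart ι p s) (a s) (b s))
      (extChartAt (𝓡 (n - 1)) p p) v =
      tensorDeriv g (ι p) (pushLin n ι p v) (a (extChartAt (𝓡 (n - 1)) p p))
        (b (extChartAt (𝓡 (n - 1)) p p))
      + tensorVal g (ι p) (fderiv ℝ a (extChartAt (𝓡 (n - 1)) p p) v)
        (b (extChartAt (𝓡 (n - 1)) p p))
      + tensorVal g (ι p) (a (extChartAt (𝓡 (n - 1)) p p))
        (fderiv ℝ b (extChartAt (𝓡 (n - 1)) p p) v) := by
  rw [← mapInChart_self] at hd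
  rw [fderiv_form_comp hd ((contDiffAt_mapInChart hι).differentiableAt (by simp)) ha hb,
    pushLin_eq hι, ← tensorCoord_self_eq, mapInChart_self]
  rfl

set_option maxSynthPendingDepth 3 in
omit [IsManifold (𝓡 n) ∞ U] in
theorem differentiableAt_tensorCoord_comp
    (hd : DifferentiableAt ℝ (tensorCoord g (ι p)) (extChartAt (𝓡 n) (ι p) (ι p)))
    (hι : ContMDiff (𝓡 (n - 1)) (𝓡 n) ∞ ι) :
    DifferentiableAt ℝ (fun s => tensorCoord g (ι p) (mapInChart ι p s))
      (extChartAt (𝓡 (n - 1)) p p) := by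
  rw [← mapInChart_self] at hd
  exact hd.comp _ ((contDiffAt_mapInChart hι).differentiableAt (by simp))

variable [IsManifold (𝓡 (n - 1)) ∞ S]

theorem differentiableAt_tensorCoord_inducedMetric
    (hd : DifferentiableAt ℝ (tensorCoord g (ι p)) (extChartAt (𝓡 n) (ι p) (ι p)))
    (hι : ContMDiff (𝓡 (n - 1)) (𝓡 n) ∞ ι) :
    DifferentiableAt ℝ (tensorCoord (inducedMetric g ι) p) (extChartAt (𝓡 (n - 1)) p p) := by
  refine differentiableAt_clm_of_apply fun a => differentiableAt_clm_of_apply fun b => ?_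
  have h := ((differentiableAt_tensorCoord_comp hd hι).clm_apply
    (differentiableAt_fderiv_apply_and hι a 0).1).clm_apply
      (differentiableAt_fderiv_apply_and hι b 0).1
  refine h.congr_of_eventuallyEq ?_
  filter_upwards [eventually_chartDomain hι] with s hs
  exact tensorCoord_inducedMetric g hι hs a b

/-- The derivative of the components `g(∂_a ι, ∂_b ι)` of the induced metric. -/
theorem tensorDeriv_inducedMetric
    (hd : DifferentiableAt ℝ (tensorCoord g (ι p)) (extChartAt (𝓡 n) (ι p) (ι p)))
    (hι : ContMDiff (𝓡 (n - 1)) (𝓡 n) ∞ ι) (v a b : EuclideanSpace ℝ (Fin (n - 1))) :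
    tensorDeriv (inducedMetric g ι) p v a b =
      tensorDeriv g (ι p) (pushLin n ι p v) (pushLin n ι p a) (pushLin n ι p b)
      + tensorVal g (ι p) (secondDeriv n ι p v a) (pushLin n ι p b)
      + tensorVal g (ι p) (pushLin n ι p a) (secondDeriv n ι p v b) := by
  rw [tensorDeriv, trilin_apply,
    ← fderiv_clm_apply₂ (differentiableAt_tensorCoord_inducedMetric hd hι)]
  have h : (fun s => tensorCoord (inducedMetric g ι) p s a b) =ᶠ[𝓝 (extChartAt (𝓡 (n - 1)) p p)]
      fun s => tensorCoord g (ι p) (mapInChart ι p s) (fderiv ℝ (mapInChart (n := n) ι p) s a)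
        (fderiv ℝ (mapInChart (n := n) ι p) s b) := by
    filter_upwards [eventually_chartDomain hι] with s hs
    exact tensorCoord_inducedMetric g hι hs a b
  rw [h.fderiv_eq, fderiv_tensorCoord_comp hd hι (differentiableAt_fderiv_apply_and hι a 0).1
    (differentiableAt_fderiv_apply_and hι b 0).1, (differentiableAt_fderiv_apply_and hι a v).2,
    (differentiableAt_fderiv_apply_and hι b v).2, pushLin_eq hι a, pushLin_eq hι b]

omit [IsManifold (𝓡 (n - 1)) ∞ S] in
theorem tensorCoord_normalInChart (g : TwoTensor n U) {s : EuclideanSpace ℝ (Fin (n - 1))}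
    (hs : s ∈ chartDomain (n := n) ι p) :
    tensorCoord g (ι p) (mapInChart ι p s) (normalInChart ι ν p s) (normalInChart ι ν p s) =
      g (ι ((extChartAt (𝓡 (n - 1)) p).symm s)) (ν ((extChartAt (𝓡 (n - 1)) p).symm s))
        (ν ((extChartAt (𝓡 (n - 1)) p).symm s)) := by
  have h1 := mfderiv_symm_normalInChart (ν := ν) hs
  exact tensor_congr g (symm_mapInChart hs) h1 h1

theorem tensorCoord_normalInChart_tangent (g : TwoTensor n U)
    (hι : ContMDiff (𝓡 (n - 1)) (𝓡 n) ∞ ι) {s : EuclideanSpace ℝ (Fin (n - 1))}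
    (hs : s ∈ chartDomain (n := n) ι p) (a : EuclideanSpace ℝ (Fin (n - 1))) :
    tensorCoord g (ι p) (mapInChart ι p s) (normalInChart ι ν p s)
        (fderiv ℝ (mapInChart (n := n) ι p) s a) =
      g (ι ((extChartAt (𝓡 (n - 1)) p).symm s)) (ν ((extChartAt (𝓡 (n - 1)) p).symm s))
        (push n ι ((extChartAt (𝓡 (n - 1)) p).symm s)
          (mfderiv 𝓘(ℝ, EuclideanSpace ℝ (Fin (n - 1))) (𝓡 (n - 1))
        (extChartAt (𝓡 (n - 1)) p).symm s a)) := by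
  have h1 := mfderiv_symm_normalInChart (ν := ν) hs
  have h2 := mfderiv_symm_mapInChart hι hs a
  exact tensor_congr g (symm_mapInChart hs) h1 h2.symm

/-- The derivative of `g(ν, ν) = 1`. -/
theorem deriv_normal_unit [IsManifold (𝓡 n) 1 U]
    (hd : DifferentiableAt ℝ (tensorCoord g (ι p)) (extChartAt (𝓡 n) (ι p) (ι p)))
    (hι : ContMDiff (𝓡 (n - 1)) (𝓡 n) ∞ ι) (hν : IsSmoothAlong ι ν) (hu : IsUnitNormal g ι ν)
    (v : EuclideanSpace ℝ (Fin (n - 1))) :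
    tensorDeriv g (ι p) (pushLin n ι p v) (ν p) (ν p)
      + tensorVal g (ι p)
        (fderiv ℝ (normalInChart ι ν p) (extChartAt (𝓡 (n - 1)) p p) v) (ν p)
      + tensorVal g (ι p) (ν p)
        (fderiv ℝ (normalInChart ι ν p) (extChartAt (𝓡 (n - 1)) p p) v) = 0 := by
  have h : (fun s => tensorCoord g (ι p) (mapInChart ι p s) (normalInChart ι ν p s)
      (normalInChart ι ν p s)) =ᶠ[𝓝 (extChartAt (𝓡 (n - 1)) p p)] fun _ => (1 : ℝ) := by
    filter_upwards [eventually_chartDomain hι] with s hs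
    rw [tensorCoord_normalInChart g hs]
    exact (hu _).1
  have hN := differentiableAt_normalInChart (p := p) hν hι
  have h2 := fderiv_tensorCoord_comp hd hι hN hN v
  rw [h.fderiv_eq, normalInChart_self] at h2
  rw [← h2]
  simp

/-- The derivative of `g(ν, ∂_a) = 0`. -/
theorem deriv_normal_tangent [IsManifold (𝓡 n) 1 U]
    (hd : DifferentiableAt ℝ (tensorCoord g (ι p)) (extChartAt (𝓡 n) (ι p) (ι p)))
    (hι : ContMDiff (𝓡 (n - 1)) (𝓡 n) ∞ ι) (hν : IsSmoothAlong ι ν) (hu : IsUnitNormal g ι ν)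
    (v a : EuclideanSpace ℝ (Fin (n - 1))) :
    tensorDeriv g (ι p) (pushLin n ι p v) (ν p) (pushLin n ι p a)
      + tensorVal g (ι p)
        (fderiv ℝ (normalInChart ι ν p) (extChartAt (𝓡 (n - 1)) p p) v) (pushLin n ι p a)
      + tensorVal g (ι p) (ν p) (secondDeriv n ι p v a) = 0 := by
  have h : (fun s => tensorCoord g (ι p) (mapInChart ι p s) (normalInChart ι ν p s)
      (fderiv ℝ (mapInChart (n := n) ι p) s a)) =ᶠ[𝓝 (extChartAt (𝓡 (n - 1)) p p)]
      fun _ => (0 : ℝ) := by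
    filter_upwards [eventually_chartDomain hι] with s hs
    rw [tensorCoord_normalInChart_tangent g hι hs]
    exact (hu _).2 _
  have hN := differentiableAt_normalInChart (p := p) hν hι
  have h2 := fderiv_tensorCoord_comp hd hι hN (differentiableAt_fderiv_apply_and hι a 0).1 v
  rw [h.fderiv_eq, normalInChart_self, (differentiableAt_fderiv_apply_and hι a v).2,
    ← pushLin_eq hι] at h2
  rw [← h2]
  simp

omit [IsManifold (𝓡 n) ∞ U] in
theorem mfderiv_symm_fieldInChart (X : (q : S) → TangentSpace (𝓡 (n - 1)) q)
    {s : EuclideanSpace ℝ (Fin (n - 1))} (hs : s ∈ (extChartAt (𝓡 (n - 1)) p).target) :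
    (mfderiv 𝓘(ℝ, EuclideanSpace ℝ (Fin (n - 1))) (𝓡 (n - 1)) (extChartAt (𝓡 (n - 1)) p).symm
        s (fieldInChart X p s) : EuclideanSpace ℝ (Fin (n - 1))) =
      X ((extChartAt (𝓡 (n - 1)) p).symm s) := by
  have : IsManifold (𝓡 (n - 1)) 1 S := .of_le (n := ∞) (by simp)
  have h := mfderivWithin_extChartAt_symm_comp_mfderiv_extChartAt (I := 𝓡 (n - 1)) hs
  rw [ModelWithCorners.range_eq_univ, mfderivWithin_univ] at h
  exact congrArg (fun T => T (X ((extChartAt (𝓡 (n - 1)) p).symm s))) h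

omit [IsManifold (𝓡 n) ∞ U] in
theorem fieldInChart_self (X : (q : S) → TangentSpace (𝓡 (n - 1)) q) :
    fieldInChart X p (extChartAt (𝓡 (n - 1)) p p) = X p := by
  have : IsManifold (𝓡 (n - 1)) 1 S := .of_le (n := ∞) (by simp)
  have h : ∀ q, q = p → (mfderiv (𝓡 (n - 1)) 𝓘(ℝ, EuclideanSpace ℝ (Fin (n - 1)))
      (extChartAt (𝓡 (n - 1)) p) q (X q) : EuclideanSpace ℝ (Fin (n - 1))) = X p := by
    rintro q rfl
    rw [mfderiv_extChartAt_self]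
    rfl
  exact h _ (extChartAt_to_inv p)

theorem tangentialDual_inChart (hs : ∀ y v w, g y v w = g y w v)
    (hp : ∀ y v, v ≠ 0 → 0 < g y v v) (hι : IsSmoothImmersion n ι)
    {s : EuclideanSpace ℝ (Fin (n - 1))} (hm : s ∈ chartDomain (n := n) ι p)
    (b : EuclideanSpace ℝ (Fin (n - 1))) :
    tensorCoord (inducedMetric g ι) p s (fieldInChart (tangentialDual g h ι ν) p s) b =
      tensorCoord h (ι p) (mapInChart ι p s) (normalInChart ι ν p s)
        (fderiv ℝ (mapInChart (n := n) ι p) s b) := by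
  rw [tensorCoord_normalInChart_tangent h hι.1 hm]
  refine Eq.trans ?_ (tangentialDual_apply hs hp hι _ _)
  rw [← mfderiv_symm_fieldInChart (tangentialDual g h ι ν) hm.1]
  rfl

/-- The components of the dual field are obtained from differentiable ones by applying the inverse
of the induced metric. -/
theorem differentiableAt_tangentialDual [IsManifold (𝓡 n) 1 U] (hs : ∀ y v w, g y v w = g y w v)
    (hp : ∀ y v, v ≠ 0 → 0 < g y v v) (hι : IsSmoothImmersion n ι) (hν : IsSmoothAlong ι ν)
    (hd : DifferentiableAt ℝ (tensorCoord g (ι p)) (extChartAt (𝓡 n) (ι p) (ι p)))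
    (hh : DifferentiableAt ℝ (tensorCoord h (ι p)) (extChartAt (𝓡 n) (ι p) (ι p))) :
    DifferentiableAt ℝ (fieldInChart (tangentialDual g h ι ν) p) (extChartAt (𝓡 (n - 1)) p p) := by
  have hinv : ∀ s ∈ chartDomain (n := n) ι p,
      (tensorCoord (inducedMetric g ι) p s).IsInvertible := fun s hm =>
    isInvertible_of_pos (tensorCoord_pos (inducedMetric_pos hp hι) hm.1)
  have h3 := differentiableAt_clm_comp
    (((differentiableAt_tensorCoord_comp hh hι.1).clm_apply
      (differentiableAt_normalInChart hν hι.1))) (differentiableAt_fderiv_mapInChart hι.1)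
  refine (differentiableAt_inverse_apply (hinv _ mem_chartDomain_self)
    (differentiableAt_tensorCoord_inducedMetric hd hι.1) h3).congr_of_eventuallyEq ?_
  filter_upwards [eventually_chartDomain hι.1] with s hm
  have h4 : (tensorCoord h (ι p) (mapInChart ι p s) (normalInChart ι ν p s)) ∘L
      fderiv ℝ (mapInChart (n := n) ι p) s =
      tensorCoord (inducedMetric g ι) p s (fieldInChart (tangentialDual g h ι ν) p s) :=
    by
    refine ContinuousLinearMap.ext fun b => ?_
    rw [ContinuousLinearMap.comp_apply, tangentialDual_inChart hs hp hι hm b]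
  rw [h4, (hinv s hm).inverse_apply_self]

/-- The derivative of `γ(X, ∂_b) = h(ν, ∂_b)`, where `X` is the dual of `h(ν, ·)`. -/
theorem deriv_tangentialDual [IsManifold (𝓡 n) 1 U] (hs : ∀ y v w, g y v w = g y w v)
    (hp : ∀ y v, v ≠ 0 → 0 < g y v v) (hι : IsSmoothImmersion n ι) (hν : IsSmoothAlong ι ν)
    (hd : DifferentiableAt ℝ (tensorCoord g (ι p)) (extChartAt (𝓡 n) (ι p) (ι p)))
    (hh : DifferentiableAt ℝ (tensorCoord h (ι p)) (extChartAt (𝓡 n) (ι p) (ι p)))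
    (v b : EuclideanSpace ℝ (Fin (n - 1))) :
    tensorDeriv (inducedMetric g ι) p v (tangentialDual g h ι ν p) b
      + tensorVal (inducedMetric g ι) p (fderiv ℝ (fieldInChart (tangentialDual g h ι ν) p)
        (extChartAt (𝓡 (n - 1)) p p) v) b =
      tensorDeriv h (ι p) (pushLin n ι p v) (ν p) (pushLin n ι p b)
      + tensorVal h (ι p)
        (fderiv ℝ (normalInChart ι ν p) (extChartAt (𝓡 (n - 1)) p p) v) (pushLin n ι p b)
      + tensorVal h (ι p) (ν p) (secondDeriv n ι p v b) := by
  have h1 : (fun s => tensorCoord (inducedMetric g ι) p s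
      (fieldInChart (tangentialDual g h ι ν) p s) b) =ᶠ[𝓝 (extChartAt (𝓡 (n - 1)) p p)]
      fun s => tensorCoord h (ι p) (mapInChart ι p s) (normalInChart ι ν p s)
        (fderiv ℝ (mapInChart (n := n) ι p) s b) := by
    filter_upwards [eventually_chartDomain hι.1] with s hm
    exact tangentialDual_inChart hs hp hι hm b
  have h2 := fderiv_tensorCoord_comp hh hι.1 (differentiableAt_normalInChart (p := p) hν hι.1)
    (differentiableAt_fderiv_apply_and hι.1 b 0).1 v
  have h3 := fderiv_form_comp (f := fun s => s)
    (differentiableAt_tensorCoord_inducedMetric hd hι.1) differentiableAt_fun_id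
    (differentiableAt_tangentialDual (h := h) hs hp hι hν hd hh) (differentiableAt_const b) v
  rw [← h1.fderiv_eq, normalInChart_self, (differentiableAt_fderiv_apply_and hι.1 b v).2,
    ← pushLin_eq hι.1] at h2
  rw [← h2, h3, fieldInChart_self, ← tensorCoord_self_eq, fderiv_fun_id, fderiv_const_apply]
  simp only [_root_.zero_apply, map_zero, add_zero]
  rfl

end Jet

/-! ### The jet of a hypersurface in a perturbed metric -/

section Perturbation

variable {n : ℕ} {M : Type*} [TopologicalSpace M] [ChartedSpace (EuclideanSpace ℝ (Fin n)) M]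
  [IsManifold (𝓡 n) ∞ M]

theorem Metric.inner_symm (g : Metric n M) (y : M) (v w : TangentSpace (𝓡 n) y) :
    g.inner y v w = g.inner y w v :=
  g.symm y v w

theorem Metric.inner_pos (g : Metric n M) (y : M) (v : TangentSpace (𝓡 n) y) (hv : v ≠ 0) :
    0 < g.inner y v v :=
  g.pos y v hv

variable {gbar g : Metric n M} {h : TwoTensor n M}

theorem perturbation_symm (hgh : ∀ x, g.inner x = gbar.inner x + h x) (y : M)
    (v w : TangentSpace (𝓡 n) y) : h y v w = h y w v := by
  have h1 := g.inner_symm y v w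
  rw [hgh] at h1
  have h2 : gbar.inner y v w + h y v w = gbar.inner y w v + h y w v := h1
  linarith [gbar.inner_symm y v w]

theorem tensorCoord_add_perturbation (hgh : ∀ x, g.inner x = gbar.inner x + h x) (x : M) :
    tensorCoord g.inner x = tensorCoord gbar.inner x + tensorCoord h x := by
  funext u
  refine ContinuousLinearMap.ext fun a => ContinuousLinearMap.ext fun b => ?_
  exact congrArg (fun T => T (mfderiv 𝓘(ℝ, EuclideanSpace ℝ (Fin n)) (𝓡 n)
    (extChartAt (𝓡 n) x).symm u a) (mfderiv 𝓘(ℝ, EuclideanSpace ℝ (Fin n)) (𝓡 n)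
    (extChartAt (𝓡 n) x).symm u b)) (hgh ((extChartAt (𝓡 n) x).symm u))

set_option maxSynthPendingDepth 3 in
theorem differentiableAt_tensorCoord_perturbation (hgh : ∀ x, g.inner x = gbar.inner x + h x)
    (x : M) : DifferentiableAt ℝ (tensorCoord h x) (extChartAt (𝓡 n) x x) := by
  have h1 : tensorCoord h x = tensorCoord g.inner x - tensorCoord gbar.inner x := by
    rw [tensorCoord_add_perturbation hgh, add_sub_cancel_left]
  rw [h1]
  exact (differentiableAt_tensorCoord g x).sub (differentiableAt_tensorCoord gbar x)

theorem tensorVal_add_perturbation (hgh : ∀ x, g.inner x = gbar.inner x + h x) (x : M) :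
    tensorVal g.inner x = tensorVal gbar.inner x + tensorVal h x :=
  LinearMap.ext fun a => LinearMap.ext fun b =>
    congrArg (fun T : EuclideanSpace ℝ (Fin n) →L[ℝ] EuclideanSpace ℝ (Fin n) →L[ℝ] ℝ => T a b)
      (hgh x)

set_option maxSynthPendingDepth 3 in
theorem tensorDeriv_add_perturbation (hgh : ∀ x, g.inner x = gbar.inner x + h x) (x : M) :
    tensorDeriv g.inner x = tensorDeriv gbar.inner x + tensorDeriv h x := by
  refine LinearMap.ext fun v => LinearMap.ext fun a => LinearMap.ext fun b => ?_
  rw [tensorDeriv, tensorCoord_add_perturbation hgh, trilin_apply,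
    fderiv_add (differentiableAt_tensorCoord gbar x)
      (differentiableAt_tensorCoord_perturbation hgh x)]
  rfl

end Perturbation

section JetOfHypersurface

variable {n : ℕ} {S U : Type*}
  [TopologicalSpace U] [ChartedSpace (EuclideanSpace ℝ (Fin n)) U] [IsManifold (𝓡 n) ∞ U]
  [TopologicalSpace S] [ChartedSpace (EuclideanSpace ℝ (Fin (n - 1))) S]
  [IsManifold (𝓡 (n - 1)) ∞ S]
  {gbar g : Metric n U} {h : TwoTensor n U} {ι : S → U}
  {νbar ν : (p : S) → TangentSpace (𝓡 n) (ι p)}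

/-- The jet at `p` of an immersed hypersurface, of the metric `ḡ` and of its perturbation
`g = ḡ + h`, in the preferred charts at `p` and `ι p`. -/
def hypersurfaceJet [IsManifold (𝓡 n) 1 U] (hn : 2 ≤ n) (hι : IsSmoothImmersion n ι)
    (hνbar : IsUnitNormal gbar.inner ι νbar) (hsm : IsSmoothAlong ι νbar)
    (hν : IsUnitNormal g.inner ι ν) (hside : PointToSameSide ι ν νbar)
    (hgh : ∀ x, g.inner x = gbar.inner x + h x) (p : S) :
    HypersurfaceJet (EuclideanSpace ℝ (Fin n)) (EuclideanSpace ℝ (Fin (n - 1))) n (n - 1) where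
  G := tensorVal gbar.inner (ι p)
  H := tensorVal h (ι p)
  DG := tensorDeriv gbar.inner (ι p)
  DH := tensorDeriv h (ι p)
  Γ := leviCivita (tensorDeriv gbar.inner (ι p)) (frame gbar.inner (ι p))
  Γg v w := leviCivita (tensorDeriv g.inner (ι p)) (frame g.inner (ι p)) v w
  L := pushLin n ι p
  B := secondDeriv n ι p
  ΓS v w := leviCivita (tensorDeriv (inducedMetric gbar.inner ι) p)
    (frame (inducedMetric gbar.inner ι) p) v w
  N := νbar p
  dN v := fderiv ℝ (normalInChart ι νbar p) (extChartAt (𝓡 (n - 1)) p p) v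
  ν := ν p
  X := tangentialDual gbar.inner h ι νbar p
  dX v := fderiv ℝ (fieldInChart (tangentialDual gbar.inner h ι νbar) p)
    (extChartAt (𝓡 (n - 1)) p p) v
  e := frame gbar.inner (ι p)
  f := frame (inducedMetric gbar.inner ι) p
  fg := frame (inducedMetric g.inner ι) p
  finrank_V := finrank_euclideanSpace_fin
  finrank_W := finrank_euclideanSpace_fin
  dim := by omega
  G_symm := gbar.inner_symm (ι p)
  H_symm := perturbation_symm hgh (ι p)
  DG_symm := tensorDeriv_symm gbar.inner_symm (differentiableAt_tensorCoord gbar _)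
  DH_symm := tensorDeriv_symm (perturbation_symm hgh)
    (differentiableAt_tensorCoord_perturbation hgh _)
  e_frame := isOrthonormalFrame_frame gbar.inner_symm gbar.inner_pos _
  f_frame := isOrthonormalFrame_frame (inducedMetric_symm gbar.inner_symm)
    (inducedMetric_pos gbar.inner_pos hι) p
  fg_frame := by
    rw [← tensorVal_add_perturbation hgh]
    exact isOrthonormalFrame_frame (inducedMetric_symm g.inner_symm)
      (inducedMetric_pos g.inner_pos hι) p
  koszul := (isOrthonormalFrame_frame gbar.inner_symm gbar.inner_pos _).koszul
    finrank_euclideanSpace_fin _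
  koszul_g := by
    rw [← tensorVal_add_perturbation hgh, ← tensorDeriv_add_perturbation hgh]
    exact (isOrthonormalFrame_frame g.inner_symm g.inner_pos _).koszul
      finrank_euclideanSpace_fin _
  B_symm := secondDeriv_symm hι.1
  koszul_S u v w := by
    have h1 := (isOrthonormalFrame_frame (inducedMetric_symm gbar.inner_symm)
      (inducedMetric_pos gbar.inner_pos hι) p).koszul finrank_euclideanSpace_fin
      (tensorDeriv (inducedMetric gbar.inner ι) p) u v w
    simp only [tensorDeriv_inducedMetric (differentiableAt_tensorCoord gbar _) hι.1] at h1
    exact h1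
  N_unit := (hνbar p).1
  N_normal := (hνbar p).2
  dN_unit v := by
    have h1 := deriv_normal_unit (differentiableAt_tensorCoord gbar _) hι.1 hsm hνbar v (p := p)
    have h2 : ∀ a, tensorVal gbar.inner (ι p) (νbar p) a = tensorVal gbar.inner (ι p) a (νbar p) :=
      gbar.inner_symm (ι p) (νbar p)
    rw [h2] at h1
    linarith
  dN_normal := deriv_normal_tangent (differentiableAt_tensorCoord gbar _) hι.1 hsm hνbar
  ν_unit := by
    rw [← tensorVal_add_perturbation hgh]
    exact (hν p).1
  ν_normal := by
    rw [← tensorVal_add_perturbation hgh]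
    exact (hν p).2
  ν_side := hside p
  X_dual := tangentialDual_apply gbar.inner_symm gbar.inner_pos hι p
  dX_dual v w := by
    have h1 := deriv_tangentialDual gbar.inner_symm gbar.inner_pos hι hsm
      (differentiableAt_tensorCoord gbar (ι p))
      (differentiableAt_tensorCoord_perturbation hgh _) v w
    have h2 := tensorDeriv_inducedMetric (differentiableAt_tensorCoord gbar (ι p)) hι.1 v
      (tangentialDual gbar.inner h ι νbar p) w
    exact (congrArg₂ (· + ·) h2.symm rfl).trans h1

variable [IsManifold (𝓡 n) 1 U] (hn : 2 ≤ n) (hι : IsSmoothImmersion n ι)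
  (hνbar : IsUnitNormal gbar.inner ι νbar) (hsm : IsSmoothAlong ι νbar)
  (hν : IsUnitNormal g.inner ι ν) (hside : PointToSameSide ι ν νbar)
  (hgh : ∀ x, g.inner x = gbar.inner x + h x) (p : S)

theorem hypersurfaceJet_nablaH (u v w : EuclideanSpace ℝ (Fin n)) :
    (hypersurfaceJet hn hι hνbar hsm hν hside hgh p).nablaH u v w =
      covDerivTensor gbar.inner h (ι p) u v w :=
  (HypersurfaceJet.nablaH_apply _ u v w).trans
    (covDerivTensor_eq (differentiableAt_tensorCoord gbar _)
      (differentiableAt_tensorCoord_perturbation hgh _) u v w).symm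

theorem hypersurfaceJet_A (v w : EuclideanSpace ℝ (Fin (n - 1))) :
    (hypersurfaceJet hn hι hνbar hsm hν hside hgh p).A v w =
      secondFundamentalForm gbar.inner ι νbar p v w :=
  congrArg (fun c => -tensorVal gbar.inner (ι p) (secondDeriv n ι p v w + c) (νbar p))
    (christoffel_eq (differentiableAt_tensorCoord gbar _) (push n ι p v) (push n ι p w)).symm

theorem hypersurfaceJet_Ag (v w : EuclideanSpace ℝ (Fin (n - 1))) :
    (hypersurfaceJet hn hι hνbar hsm hν hside hgh p).Ag v w =
      secondFundamentalForm g.inner ι ν p v w :=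
  congrArg₂ (fun (T : EuclideanSpace ℝ (Fin n) →ₗ[ℝ] EuclideanSpace ℝ (Fin n) →ₗ[ℝ] ℝ) c =>
      -T (secondDeriv n ι p v w + c) (ν p)) (tensorVal_add_perturbation hgh _).symm
    (christoffel_eq (differentiableAt_tensorCoord g _) (push n ι p v) (push n ι p w)).symm

theorem hypersurfaceJet_normH :
    (hypersurfaceJet hn hι hνbar hsm hν hside hgh p).normH = tensorNorm gbar.inner h (ι p) := rfl

theorem hypersurfaceJet_normNablaH :
    (hypersurfaceJet hn hι hνbar hsm hν hside hgh p).normNablaH =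
      covDerivNorm gbar.inner h (ι p) := by
  simp only [HypersurfaceJet.normNablaH, hypersurfaceJet_nablaH]
  rfl

theorem hypersurfaceJet_normA :
    (hypersurfaceJet hn hι hνbar hsm hν hside hgh p).normA =
      secondFundamentalFormNorm gbar.inner ι νbar p := by
  simp only [HypersurfaceJet.normA, hypersurfaceJet_A]
  rfl

/-- `HypersurfaceJet.meanCurvature_sub` in terms of the geometric objects. -/
theorem meanCurvature_sub_eq :
    2 * (meanCurvature g.inner ι ν p - meanCurvature gbar.inner ι νbar p) =
      (mvfderiv (𝓡 n) (trace gbar.inner h) (ι p) (νbar p)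
          - divTensor gbar.inner h (ι p) (νbar p))
        - divField (inducedMetric gbar.inner ι) (tangentialDual gbar.inner h ι νbar) p
        - innerSecondFundamentalForm gbar.inner h ι νbar p
        + (hypersurfaceJet hn hι hνbar hsm hν hside hgh p).curvatureRemainder
        + (hypersurfaceJet hn hι hνbar hsm hν hside hgh p).derivativeRemainder := by
  have h1 := (hypersurfaceJet hn hι hνbar hsm hν hside hgh p).meanCurvature_sub
  simp only [hypersurfaceJet_A, hypersurfaceJet_Ag, hypersurfaceJet_nablaH] at h1
  have h2 : divField (inducedMetric gbar.inner ι) (tangentialDual gbar.inner h ι νbar) p =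
      ∑ a, tensorVal gbar.inner (ι p) (pushLin n ι p
        (fderiv ℝ (fieldInChart (tangentialDual gbar.inner h ι νbar) p)
          (extChartAt (𝓡 (n - 1)) p p) (frame (inducedMetric gbar.inner ι) p a)
        + leviCivita (tensorDeriv (inducedMetric gbar.inner ι) p)
          (frame (inducedMetric gbar.inner ι) p) (frame (inducedMetric gbar.inner ι) p a)
            (tangentialDual gbar.inner h ι νbar p)))
        (pushLin n ι p (frame (inducedMetric gbar.inner ι) p a)) := by
    rw [divField]
    refine Finset.sum_congr rfl fun a _ => ?_
    rw [covDerivField, christoffel_eq (differentiableAt_tensorCoord_inducedMetric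
      (differentiableAt_tensorCoord gbar _) hι.1)]
    rfl
  rw [mvfderiv_trace gbar.inner_symm gbar.inner_pos (differentiableAt_tensorCoord gbar _)
    (differentiableAt_tensorCoord_perturbation hgh _), h2]
  exact h1

end JetOfHypersurface

end HypersurfaceGeometry

end

open HypersurfaceGeometry in
theorem proposition2p1 (n : ℕ) (hn : 2 ≤ n) (ε : ℝ) (hε : 0 < ε) (hεn : ε < 1 / ((n : ℝ) - 1)) :
    ∃ C : ℝ,
      ∀ (U : Type*) [TopologicalSpace U] [ChartedSpace (EuclideanSpace ℝ (Fin n)) U]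
        [IsManifold (𝓡 n) ∞ U]
        (S : Type*) [TopologicalSpace S] [ChartedSpace (EuclideanSpace ℝ (Fin (n - 1))) S]
        [IsManifold (𝓡 (n - 1)) ∞ S]
        (gbar g : Metric n U) (h : TwoTensor n U)
        (ι : S → U) (νbar ν : (p : S) → TangentSpace (𝓡 n) (ι p)),
        IsSmoothImmersion n ι →
        IsUnitNormal gbar.inner ι νbar →
        IsSmoothAlong ι νbar →
        IsUnitNormal g.inner ι ν →
        PointToSameSide ι ν νbar →
        (∀ x : U, g.inner x = gbar.inner x + h x) →
        (∀ x : U, tensorNorm gbar.inner h x < ε) →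
        ∃ R₁ R₂ : S → ℝ,
          (∀ p : S, |R₁ p| ≤ C * tensorNorm gbar.inner h (ι p) ^ 2) ∧
          (∀ p : S, |R₂ p| ≤
            C * (covDerivNorm gbar.inner h (ι p) * tensorNorm gbar.inner h (ι p))) ∧
          ∀ p : S,
            2 * (meanCurvature g.inner ι ν p
                - meanCurvature gbar.inner ι νbar p) =
              (mvfderiv (𝓡 n) (trace gbar.inner h) (ι p) (νbar p)
                  - divTensor gbar.inner h (ι p) (νbar p))
                - divField (inducedMetric gbar.inner ι)
                    (tangentialDual gbar.inner h ι νbar) p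
                - innerSecondFundamentalForm gbar.inner h ι νbar p
                + secondFundamentalFormNorm gbar.inner ι νbar p * R₁ p
                + R₂ p := by
  have hm : (1 : ℝ) ≤ (n : ℝ) - 1 := by
    have : (2 : ℝ) ≤ n := by exact_mod_cast hn
    linarith
  have hε1 : 0 < 1 - ε := by
    have : 1 / ((n : ℝ) - 1) ≤ 1 := (div_le_one (by linarith)).2 hm
    linarith
  -- `K` bounds the inverse of `1 - |h|`, hence of the metric induced by `g`
  set K : ℝ := 1 / (1 - ε) with hKdef
  have hK0 : 0 < K := by positivity
  set m : ℝ := ((n - 1 : ℕ) : ℝ)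
  have hm0 : 0 ≤ m := Nat.cast_nonneg _
  set C₁ : ℝ := 2 * (2 + K) * (m ^ 5 * K) + 2 * (1 + 2 * K) * m + 2 * (1 + K) * m ^ 2
  set C₂ : ℝ := 3 * m * ((1 + K) * K + K ^ 2) + 3 * m ^ 4 * K ^ 2
  have hC₁ : 0 ≤ C₁ := by positivity
  have hC₂ : 0 ≤ C₂ := by positivity
  refine ⟨C₁ + C₂, ?_⟩
  intro U _ _ _ S _ _ _ gbar g h ι νbar ν hι hνbar hsm hν hside hgh hsmall
  have : IsManifold (𝓡 n) 1 U := .of_le (n := ∞) (by simp)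
  let J := fun p => hypersurfaceJet hn hι hνbar hsm hν hside hgh p
  have hη : ∀ p, (J p).normH ≤ 1 := fun p => by
    linarith [hsmall (ι p), hypersurfaceJet_normH hn hι hνbar hsm hν hside hgh p]
  have hK : ∀ p, 1 ≤ K * (1 - (J p).normH) := fun p => by
    rw [hKdef, one_div_mul_eq_div, one_le_div hε1]
    linarith [hsmall (ι p), hypersurfaceJet_normH hn hι hνbar hsm hν hside hgh p]
  have h1 : ∀ p, |(J p).curvatureRemainder| ≤ secondFundamentalFormNorm gbar.inner ι νbar p *
      (C₁ * tensorNorm gbar.inner h (ι p) ^ 2) := fun p => by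
    have := (J p).abs_curvatureRemainder_le (hK p) (hη p)
    rw [hypersurfaceJet_normA, hypersurfaceJet_normH] at this
    linarith
  have hA : ∀ p, 0 ≤ secondFundamentalFormNorm gbar.inner ι νbar p := fun p => Real.sqrt_nonneg _
  refine ⟨fun p => (J p).curvatureRemainder / secondFundamentalFormNorm gbar.inner ι νbar p,
    fun p => (J p).derivativeRemainder, fun p => ?_, fun p => ?_, fun p => ?_⟩
  · rw [abs_div, abs_of_nonneg (hA p)]
    refine (div_le_of_le_mul₀ (hA p) (by positivity) ?_).trans
      (mul_le_mul_of_nonneg_right (le_add_of_nonneg_right hC₂) (sq_nonneg _))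
    rw [mul_comm]
    exact h1 p
  · have h2 := (J p).abs_derivativeRemainder_le (hK p) (hη p)
    rw [hypersurfaceJet_normNablaH, hypersurfaceJet_normH] at h2
    exact h2.trans (mul_le_mul_of_nonneg_right (le_add_of_nonneg_left hC₁)
      (mul_nonneg (Real.sqrt_nonneg _) (Real.sqrt_nonneg _)))
  · -- where `Ā` vanishes, so does the curvature remainder, and the division by zero is harmless
    have h3 : secondFundamentalFormNorm gbar.inner ι νbar p *
        ((J p).curvatureRemainder / secondFundamentalFormNorm gbar.inner ι νbar p) =
        (J p).curvatureRemainder := by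
      refine mul_div_cancel_of_imp' fun h0 => ?_
      have h4 := h1 p
      rwa [h0, zero_mul, abs_nonpos_iff] at h4
    rw [h3]
    exact meanCurvature_sub_eq hn hι hνbar hsm hν hside hgh p
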